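/- Let $N\ge 1$, let $\Omega\subset\mathbb R^N$ be a bounded domain, $|\Omega|$ its Lebesgue measure, $(\cdot,\cdot)$ and $|\cdot|$ the scalar product and norm of $L^2(\Omega)$ (and of $L^2(\Omega)^N$), $H^{-1}(\Omega)$ the dual of $H^1_0(\Omega)$ with duality product $\langle\cdot,\cdot\rangle$ and with the norm $\|\cdot\|_*$ dual to $\|v\|=|\nabla v|$, and $\lambda_1>0$ the first eigenvalue of $-\Delta$ on $\Omega$ with homogeneous Dirichlet boundary condition. Assume (A1): there are constants $\alpha_1,\alpha_2,m>0$, $\kappa_1,\kappa_2\ge 0$, $p\ge 2$ such that for every $\eta\in(0,1]$: $a_\eta\in C(\mathbb R;[m,\infty))$; $f_\eta\in C(\mathbb R)$ satisfies $|f_\eta(s)|\le\kappa_1+\alpha_1|s|^{p-1}$ and $f_\eta(s)s\le\kappa_2-\alpha_2|s|^p$ for all $s\in\mathbb R$; $h_\eta\in L^2_{loc}(\mathbb R;H^{-1}(\Omega))$; and $l_\eta\in L^2(\Omega)$. Let $\eta\in(0,1]$, $\tau\in\mathbb R$, $u_\tau\in L^2(\Omega)$, and let $u$ be a weak solution of $$(P_\eta)\quad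 \frac{\partial u}{\partial t}-a_\eta((l_\eta,u))\Delta u=f_\eta(u)+h_\eta(t)\ \text{ in }\Omega\times(\tau,\infty),\quad u=0\ \text{ on }\partial\Omega\times(\tau,\infty),\quad u(\cdot,\tau)=u_\tau\ \text{ in }\Omega,$$ that is, $u\in L^\infty(\tau,T;L^2(\Omega))\cap L^2(\tau,T;H^1_0(\Omega))\cap L^p(\tau,T;L^p(\Omega))$ for every $T>\tau$, for all $v\in H^1_0(\Omega)\cap L^p(\Omega)$ the equation $$\frac{d}{dt}(u,v)+a_\eta((l_\eta,u))(\nabla u,\nabla v)=(f_\eta(u),v)+\langle h_\eta,v\rangle$$ holds in the sense of scalar distributions on $(\tau,\infty)$, and $u(\tau)=u_\tau$ in the sense that $(u(t),v)\to(u_\tau,v)$ as $t\downarrow\tau$ outside a null set of times, for all such $v$. Then $u$ has a representative in $C([\tau,\infty);L^2(\Omega))$ with value $u_\tau$ at $\tau$, and this representative satisfies, for every $\mu\in(0,2m\lambda_1)$ and every $t\ge\tau$, $$|u(t)|^2\le e^{-\mu(t-\tau)}|u_\tau|^2+\frac{2\kappa_2|\Omega|}{\mu}+\frac{1}{2\left(m-\mu(2\lambda_1)^{-1}\right)}e^{-\mu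 t}\int_\tau^t e^{\mu s}\|h_\eta(s)\|_*^2\,ds.$$ -/

import Mathlib

open MeasureTheory Set Filter Topology
open scoped ContDiff ENNReal InnerProductSpace

noncomputable section

/-- The space `L²(Ω)` of real functions, for `Ω ⊆ ℝ^N` with Lebesgue measure. -/
abbrev L2 {N : ℕ} (Ω : Set (EuclideanSpace ℝ (Fin N))) : Type :=
  Lp ℝ 2 (volume.restrict Ω)

/-- The space `L²(Ω)^N` of square integrable vector fields. -/
abbrev L2Vec {N : ℕ} (Ω : Set (EuclideanSpace ℝ (Fin N))) : Type :=
  Lp (EuclideanSpace ℝ (Fin N)) 2 (volume.restrict Ω)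

/-- `φ` is a test function on the open set `U`, that is `φ ∈ C_c^∞(U)`. -/
structure IsTestFunction {F : Type*} [NormedAddCommGroup F] [NormedSpace ℝ F]
    (U : Set F) (φ : F → ℝ) : Prop where
  contDiff : ContDiff ℝ ∞ φ
  hasCompactSupport : HasCompactSupport φ
  tsupport_subset : tsupport φ ⊆ U

/-- The pairs `(φ, ∇φ) ∈ L²(Ω) × L²(Ω)^N` with `φ ∈ C_c^∞(Ω)`. -/
def testPairs {N : ℕ} (Ω : Set (EuclideanSpace ℝ (Fin N))) :
    Submodule ℝ (WithLp 2 (L2 Ω × L2Vec Ω)) where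
  carrier := {z | ∃ φ : EuclideanSpace ℝ (Fin N) → ℝ, IsTestFunction Ω φ ∧
    z.fst =ᵐ[volume.restrict Ω] φ ∧ z.snd =ᵐ[volume.restrict Ω] gradient φ}
  zero_mem' := by
    refine ⟨fun _ => 0, ⟨contDiff_const, HasCompactSupport.zero, ?_⟩, ?_, ?_⟩
    · simp [tsupport]
    · exact Lp.coeFn_zero _ _ _
    · filter_upwards [Lp.coeFn_zero (EuclideanSpace ℝ (Fin N)) 2 (volume.restrict Ω)] with x hx
      rw [gradient_fun_const]
      exact hx
  add_mem' := by
    rintro y z ⟨φ, hφ, h1, h2⟩ ⟨ψ, hψ, h3, h4⟩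
    refine ⟨φ + ψ, ⟨hφ.contDiff.add hψ.contDiff,
      hφ.hasCompactSupport.add hψ.hasCompactSupport,
      (tsupport_add φ ψ).trans (union_subset hφ.tsupport_subset hψ.tsupport_subset)⟩, ?_, ?_⟩
    · exact (Lp.coeFn_add y.fst z.fst).trans (h1.add h3)
    · filter_upwards [Lp.coeFn_add y.snd z.snd, h2, h4] with x hx h2 h4
      rw [WithLp.add_snd, hx, Pi.add_apply, h2, h4]
      simp only [gradient]
      rw [fderiv_add (hφ.contDiff.differentiable (by simp) x)
        (hψ.contDiff.differentiable (by simp) x), map_add]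
  smul_mem' := by
    rintro c z ⟨φ, hφ, h1, h2⟩
    refine ⟨c • φ, ⟨hφ.contDiff.const_smul c, hφ.hasCompactSupport.smul_left,
      (closure_mono (Function.support_const_smul_subset c φ)).trans hφ.tsupport_subset⟩, ?_, ?_⟩
    · exact (Lp.coeFn_smul c z.fst).trans (h1.const_smul c)
    · filter_upwards [Lp.coeFn_smul c z.snd, h2] with x hx h2
      rw [WithLp.smul_snd, hx, Pi.smul_apply, h2]
      simp only [gradient]
      rw [fderiv_const_smul (hφ.contDiff.differentiable (by simp) x), map_smul]

/-- The Sobolev space `H¹₀(Ω)`: the closure of `C_c^∞(Ω)` in the `H¹` norm. A function `v` of this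
space is recorded together with its weak gradient, as the pair `(v, ∇v)`; the norm inherited from
`L²(Ω) × L²(Ω)^N` is the `H¹` norm `(|v|² + |∇v|²)^{1/2}`. -/
def H10 {N : ℕ} (Ω : Set (EuclideanSpace ℝ (Fin N))) :
    Submodule ℝ (WithLp 2 (L2 Ω × L2Vec Ω)) :=
  (testPairs Ω).topologicalClosure

/-- The embedding `H¹₀(Ω) ⊂ L²(Ω)`. -/
def toL2 {N : ℕ} {Ω : Set (EuclideanSpace ℝ (Fin N))} (v : H10 Ω) : L2 Ω :=
  (v : WithLp 2 (L2 Ω × L2Vec Ω)).fst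

/-- The weak gradient of an element of `H¹₀(Ω)`. -/
def weakGrad {N : ℕ} {Ω : Set (EuclideanSpace ℝ (Fin N))} (v : H10 Ω) : L2Vec Ω :=
  (v : WithLp 2 (L2 Ω × L2Vec Ω)).snd

/-- `H⁻¹(Ω)`, the topological dual of `H¹₀(Ω)`. -/
abbrev HMinusOne {N : ℕ} (Ω : Set (EuclideanSpace ℝ (Fin N))) : Type :=
  StrongDual ℝ (H10 Ω)

/-- The norm `‖ξ‖_*` of `H⁻¹(Ω)` dual to the norm `‖v‖ = |∇v|` of `H¹₀(Ω)`: the least `C ≥ 0` with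
`|⟨ξ, v⟩| ≤ C |∇v|` for all `v ∈ H¹₀(Ω)`. -/
def dualNorm {N : ℕ} {Ω : Set (EuclideanSpace ℝ (Fin N))} (ξ : HMinusOne Ω) : ℝ :=
  sInf {C : ℝ | 0 ≤ C ∧ ∀ v : H10 Ω, |ξ v| ≤ C * ‖weakGrad v‖}

/-- `lam` is an eigenvalue of `-Δ` on `Ω` with homogeneous Dirichlet boundary condition. -/
def IsDirichletEigenvalue {N : ℕ} (Ω : Set (EuclideanSpace ℝ (Fin N))) (lam : ℝ) : Prop :=
  ∃ v : H10 Ω, v ≠ 0 ∧ ∀ w : H10 Ω, ⟪weakGrad v, weakGrad w⟫_ℝ = lam * ⟪toL2 v, toL2 w⟫_ℝ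

/-- `λ₁`, the first eigenvalue of `-Δ` on `Ω` with homogeneous Dirichlet boundary condition. -/
def firstEigenvalue {N : ℕ} (Ω : Set (EuclideanSpace ℝ (Fin N))) : ℝ :=
  sInf {lam : ℝ | IsDirichletEigenvalue Ω lam}

/-- The standing assumption (A1) on the families `a_η`, `f_η`, `h_η`, `l_η`, `η ∈ (0,1]`, with
constants independent of `η`. -/
structure AssumptionA1 {N : ℕ} {Ω : Set (EuclideanSpace ℝ (Fin N))}
    (α₁ α₂ m κ₁ κ₂ p : ℝ) (a f : Ioc (0 : ℝ) 1 → ℝ → ℝ)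
    (h : Ioc (0 : ℝ) 1 → ℝ → HMinusOne Ω) : Prop where
  α₁_pos : 0 < α₁
  α₂_pos : 0 < α₂
  m_pos : 0 < m
  κ₁_nonneg : 0 ≤ κ₁
  κ₂_nonneg : 0 ≤ κ₂
  two_le_p : 2 ≤ p
  continuous_a : ∀ η, Continuous (a η)
  le_a : ∀ η s, m ≤ a η s
  continuous_f : ∀ η, Continuous (f η)
  growth_f : ∀ η s, |f η s| ≤ κ₁ + α₁ * |s| ^ (p - 1)
  dissipative_f : ∀ η s, f η s * s ≤ κ₂ - α₂ * |s| ^ p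
  /-- `h_η ∈ L²_loc(ℝ; H⁻¹(Ω))` -/
  memLp_h : ∀ η (b c : ℝ), MemLp (h η) 2 (volume.restrict (Ioo b c))

/-- `u` is a weak solution on `(τ, ∞)` of `∂u/∂t - a(l(u)) Δu = f(u) + h(t)` in `Ω`, `u = 0` on
`∂Ω`, `u(τ) = u_τ`. As an element of Bochner spaces `u` matters only up to a null set of times, and
its values are taken in `H¹₀(Ω)`, as `u ∈ L²(τ,T; H¹₀(Ω))` permits. -/
structure IsWeakSolution {N : ℕ} {Ω : Set (EuclideanSpace ℝ (Fin N))} (p : ℝ) (a f : ℝ → ℝ)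
    (l : L2 Ω) (h : ℝ → HMinusOne Ω) (τ : ℝ) (uτ : L2 Ω) (u : ℝ → H10 Ω) : Prop where
  /-- `u ∈ L^∞(τ,T; L²(Ω))` -/
  memLp_top : ∀ T, τ < T → MemLp (fun t => toL2 (u t)) ⊤ (volume.restrict (Ioo τ T))
  /-- `u ∈ L²(τ,T; H¹₀(Ω))` -/
  memLp_two : ∀ T, τ < T → MemLp u 2 (volume.restrict (Ioo τ T))
  /-- `u ∈ L^p(τ,T; L^p(Ω))` -/
  lintegral_p : ∀ T, τ < T →
    ∫⁻ t in Ioo τ T, ∫⁻ x in Ω, ‖(toL2 (u t)) x‖ₑ ^ p < ⊤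
  /-- `d/dt (u,v) + a(l(u)) (∇u,∇v) = (f(u),v) + ⟨h,v⟩` in the sense of distributions on `(τ,∞)`,
  for all `v ∈ H¹₀(Ω) ∩ L^p(Ω)` -/
  equation : ∀ v : H10 Ω, MemLp (toL2 v) (ENNReal.ofReal p) (volume.restrict Ω) →
    ∀ φ : ℝ → ℝ, IsTestFunction (Ioi τ) φ →
      -(∫ t in Ioi τ, deriv φ t * ⟪toL2 (u t), toL2 v⟫_ℝ)
        + ∫ t in Ioi τ, φ t * (a ⟪l, toL2 (u t)⟫_ℝ * ⟪weakGrad (u t), weakGrad v⟫_ℝ)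
      = ∫ t in Ioi τ, φ t * ((∫ x in Ω, f ((toL2 (u t)) x) * (toL2 v) x) + h t v)
  /-- `u(τ) = u_τ`: for `v ∈ H¹₀(Ω) ∩ L^p(Ω)`, the function `t ↦ (u(t),v)`, whose derivative is
  integrable near `τ`, takes the value `(u_τ,v)` at `τ` (as a limit outside a null set of times) -/
  initial : ∀ v : H10 Ω, MemLp (toL2 v) (ENNReal.ofReal p) (volume.restrict Ω) →
    Tendsto (fun t => ⟪toL2 (u t), toL2 v⟫_ℝ) (𝓝[>] τ ⊓ ae volume) (𝓝 ⟪uτ, toL2 v⟫_ℝ)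

end

/-!
The idea is the energy method. Formally, testing the equation with `u` gives
`d/dt |u|² = -2 a |∇u|² + 2 (f(u), u) + 2 ⟨h, u⟩`. Here `(f(u), u) ≤ κ₂ |Ω|` by dissipativity; by
Poincaré's inequality a part of `2 m |∇u|²` dominates `μ |u|²`, and by Young's inequality the rest,
`2 (m - μ / (2 λ₁)) |∇u|²`, absorbs `2 ⟨h, u⟩` at the price of a multiple of `‖h‖_*²`
(`neg_mul_norm_sq_add_apply_le`, `integral_mul_self_le`). The claim is then Gronwall's inequality
(`exp_mul_le_of_deriv_le`).

Two ingredients need proof. The first is Poincaré's inequality with the constant `λ₁`, where `λ₁` is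
the infimum of all eigenvalues (`firstEigenvalue_mul_norm_sq_le`). The infimum of the Rayleigh
quotient is attained, hence is an eigenvalue, because bounded sequences in `H¹₀(Ω)` have
subsequences that converge in `L²(Ω)`. That compactness is obtained from the Fourier transform:
along a weakly convergent sequence the transforms converge pointwise, low frequencies are handled by
dominated convergence, and high ones are controlled by the gradient
(`exists_subseq_cauchySeq_of_testPairs`).

The second is that a weak solution is continuous in `L²(Ω)` and satisfies the energy equality,
although `u'` only lies in `L²(H⁻¹) + L^q(L^q)`. The weak formulation, integrated in time
(`ae_eq_add_integral_of_weak_deriv`) and tested with the values `u(s)` themselves, expresses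
`(u(t) - u_τ, u(s))` through `∫ u'`; this is the notion `IsWeakEvolution`. It follows that
`|u(r + k)|² - |u(r)|² = ⟨∫_r^{r+k} u', u(r + k) + u(r)⟩`. Dividing by `k`, integrating over `r` and
letting `k → 0` gives the energy equality between almost all times (`exists_energy_identity`),
since translations act continuously on `L^p(ℝ; X)` for `p < ∞`. The same identity for the increment
`u(· + k) - u` bounds it uniformly in time (`IsWeakEvolution.exists_modulus`). Thus `u` is, on
bounded time intervals, uniformly continuous off a null set, and it extends to a continuous curve
(`IsWeakEvolution.exists_continuousOn`); the value at `τ` is `u_τ` because the curve is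
weakly continuous up to `τ`.
-/

/-! ### Plancherel's identity for test functions and their gradients -/

open scoped FourierTransform SchwartzMap LineDeriv in
/-- Plancherel's identity for the gradient: `∂ᵢ` becomes multiplication by `2πi ξᵢ`. -/
theorem SchwartzMap.integral_norm_sq_fderiv_eq {N : ℕ}
    (f : 𝓢(EuclideanSpace ℝ (Fin N), ℂ)) :
    Integrable (fun ξ => ‖ξ‖ ^ 2 * ‖(𝓕 f) ξ‖ ^ 2) ∧
    ∑ i, ∫ x, ‖fderiv ℝ f x (EuclideanSpace.single i 1)‖ ^ 2
      = ∫ ξ, (2 * Real.pi) ^ 2 * (‖ξ‖ ^ 2 * ‖(𝓕 f) ξ‖ ^ 2) := by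
  have hpt : ∀ i : Fin N, ∀ ξ, ‖(𝓕 (∂_{EuclideanSpace.single i (1:ℝ)} f)) ξ‖ ^ 2
      = (2 * Real.pi) ^ 2 * (ξ i ^ 2 * ‖(𝓕 f) ξ‖ ^ 2) := by
    intro i ξ
    have : (fun ξ : EuclideanSpace ℝ (Fin N) =>
      inner ℝ ξ (EuclideanSpace.single i (1:ℝ))).HasTemperateGrowth :=
      ((innerSL ℝ).flip (EuclideanSpace.single i (1:ℝ))).hasTemperateGrowth
    rw [SchwartzMap.fourier_lineDerivOp_eq]
    have hi : inner ℝ ξ (EuclideanSpace.single i (1:ℝ)) = ξ i := by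
      simp [EuclideanSpace.inner_single_right]
    simp only [_root_.smul_apply, SchwartzMap.smulLeftCLM_apply_apply this, hi]
    simp [mul_pow]
  have hint : ∀ i : Fin N, Integrable (fun ξ => (2 * Real.pi) ^ 2 * (ξ i ^ 2 * ‖(𝓕 f) ξ‖ ^ 2)) := by
    intro i
    simp_rw [← hpt i]
    exact (SchwartzMap.memLp _ 2 volume).integrable_norm_pow (by norm_num)
  have hsum : ∀ ξ : EuclideanSpace ℝ (Fin N), (2 * Real.pi) ^ 2 * (‖ξ‖ ^ 2 * ‖(𝓕 f) ξ‖ ^ 2) =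
      ∑ i, (2 * Real.pi) ^ 2 * (ξ i ^ 2 * ‖(𝓕 f) ξ‖ ^ 2) := by
    intro ξ
    rw [EuclideanSpace.real_norm_sq_eq, Finset.sum_mul, Finset.mul_sum]
  refine ⟨?_, ?_⟩
  · have h1 : Integrable (fun ξ => (2 * Real.pi) ^ 2 * (‖ξ‖ ^ 2 * ‖(𝓕 f) ξ‖ ^ 2)) := by
      simp_rw [hsum]
      exact integrable_finsetSum _ fun i _ => hint i
    have h2 := h1.const_mul (((2 * Real.pi) ^ 2)⁻¹)
    refine h2.congr (ae_of_all _ fun ξ => ?_)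
    have : (2 * Real.pi) ^ 2 ≠ 0 := by positivity
    simp only
    field_simp
  · simp_rw [hsum]
    rw [integral_finsetSum _ fun i _ => hint i]
    refine Finset.sum_congr rfl fun i _ => ?_
    simp_rw [← hpt i]
    rw [SchwartzMap.integral_norm_sq_fourier]
    rfl

theorem gradient_norm_sq_eq_sum {N : ℕ} (φ : EuclideanSpace ℝ (Fin N) → ℝ)
    (x : EuclideanSpace ℝ (Fin N)) :
    ‖gradient φ x‖ ^ 2 = ∑ i, (fderiv ℝ φ x (EuclideanSpace.single i 1)) ^ 2 := by
  rw [EuclideanSpace.real_norm_sq_eq]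
  refine Finset.sum_congr rfl fun i _ => ?_
  congr 1
  have := (InnerProductSpace.toDual_symm_apply (𝕜 := ℝ) (x := EuclideanSpace.single i (1:ℝ))
    (y := fderiv ℝ φ x))
  rw [← this, EuclideanSpace.inner_single_right]
  simp [gradient]

open scoped FourierTransform in
/-- The frequencies above `R` carry at most `|∇φ|² / (2πR)²` of the `L²` norm of a test function.
-/
theorem integral_sq_le_fourier_add_gradient {N : ℕ} {φ : EuclideanSpace ℝ (Fin N) → ℝ}
    (hφ : ContDiff ℝ ∞ φ) (hc : HasCompactSupport φ) {R : ℝ} (hR : 0 < R) :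
    Continuous (𝓕 (fun x => (φ x : ℂ))) ∧
    ∫ x, φ x ^ 2 ≤ (∫ ξ in Metric.ball 0 R, ‖𝓕 (fun x => (φ x : ℂ)) ξ‖ ^ 2) +
      (∫ x, ‖gradient φ x‖ ^ 2) / (2 * Real.pi * R) ^ 2 := by
  have hc' : HasCompactSupport (fun x => (φ x : ℂ)) := hc.comp_left (g := ((↑) : ℝ → ℂ)) (by simp)
  have hφ' : ContDiff ℝ ∞ (fun x => (φ x : ℂ)) := Complex.ofRealCLM.contDiff.comp hφ
  set f : SchwartzMap (EuclideanSpace ℝ (Fin N)) ℂ := hc'.toSchwartzMap hφ' with hf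
  have hfx : ∀ x, f x = (φ x : ℂ) := fun x => rfl
  set g : SchwartzMap (EuclideanSpace ℝ (Fin N)) ℂ := 𝓕 f with hg
  have hF : 𝓕 (fun x => (φ x : ℂ)) = ⇑g := (SchwartzMap.fourier_coe f).symm
  have hFc : Continuous (⇑g) := g.continuous
  rw [hF]
  refine ⟨hFc, ?_⟩
  have h1 : ∫ x, φ x ^ 2 = ∫ ξ, ‖g ξ‖ ^ 2 := by
    rw [SchwartzMap.integral_norm_sq_fourier]
    simp [hfx]
  obtain ⟨hi, h2⟩ := SchwartzMap.integral_norm_sq_fderiv_eq f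
  have hI : Integrable (fun ξ => ‖g ξ‖ ^ 2) :=
    (SchwartzMap.memLp g 2 volume).integrable_norm_pow (by norm_num)
  have hderiv : ∀ x v, ‖fderiv ℝ f x v‖ ^ 2 = (fderiv ℝ φ x v) ^ 2 := by
    intro x v
    have hd : HasFDerivAt f (Complex.ofRealCLM.comp (fderiv ℝ φ x)) x :=
      Complex.ofRealCLM.hasFDerivAt.comp x (hφ.differentiable (by simp) x).hasFDerivAt
    rw [hd.fderiv]
    simp
  have h3 : ∫ x, ‖gradient φ x‖ ^ 2 = ∫ ξ, (2 * Real.pi) ^ 2 * (‖ξ‖ ^ 2 * ‖g ξ‖ ^ 2) := by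
    rw [← h2]
    simp_rw [gradient_norm_sq_eq_sum, hderiv]
    refine integral_finsetSum _ fun i _ => ?_
    have hcd : Continuous (fun x => (fderiv ℝ φ x (EuclideanSpace.single i 1)) ^ 2) :=
      ((hφ.continuous_fderiv (by simp)).clm_apply continuous_const).pow 2
    refine hcd.integrable_of_hasCompactSupport ?_
    exact (hc.fderiv ℝ).mono' (fun x hx => subset_closure (by
      intro h0
      simp [h0] at hx))
  rw [h1, h3, ← integral_add_compl (measurableSet_ball (x := (0 : EuclideanSpace ℝ (Fin N)))
    (ε := R)) hI]
  gcongr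
  rw [← integral_div]
  refine le_trans ?_ (setIntegral_le_integral (s := (Metric.ball 0 R)ᶜ)
    ((hi.const_mul _).div_const _) (ae_of_all _ fun ξ => by positivity))
  refine setIntegral_mono_on hI.integrableOn ((hi.const_mul _).div_const _).integrableOn
    measurableSet_ball.compl fun ξ hξ => ?_
  have hξ' : R ≤ ‖ξ‖ := by simpa using hξ
  have : R ^ 2 ≤ ‖ξ‖ ^ 2 := by gcongr
  have hpi := Real.pi_pos
  rw [le_div_iff₀ (by positivity)]
  have h0 : 0 ≤ ‖g ξ‖ ^ 2 := by positivity
  calc ‖g ξ‖ ^ 2 * (2 * Real.pi * R) ^ 2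
      = (2 * Real.pi) ^ 2 * (R ^ 2 * ‖g ξ‖ ^ 2) := by ring
    _ ≤ _ := by gcongr

/-! ### Precompactness of bounded sets of test functions in `L²(Ω)` -/

theorem L2_norm_sq_eq_integral {α F : Type*} [MeasurableSpace α] {μ : Measure α}
    [NormedAddCommGroup F] [InnerProductSpace ℝ F] {x : Lp F 2 μ} {φ : α → F} (h : x =ᵐ[μ] φ) :
    ‖x‖ ^ 2 = ∫ y, ‖φ y‖ ^ 2 ∂μ := by
  rw [← real_inner_self_eq_norm_sq, L2.inner_def]
  refine integral_congr_ae ?_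
  filter_upwards [h] with y hy
  rw [real_inner_self_eq_norm_sq, hy]

open scoped FourierTransform in
/-- On `L²(Ω)` with `|Ω| < ∞` the Fourier transform at a frequency `ξ` is a continuous functional,
bounded uniformly in `ξ`. -/
theorem exists_fourier_functional {N : ℕ} (Ω : Set (EuclideanSpace ℝ (Fin N)))
    [IsFiniteMeasure (volume.restrict Ω)] :
    ∃ (K : ℝ) (L : EuclideanSpace ℝ (Fin N) → (L2 Ω →L[ℝ] ℂ)), (∀ ξ, ‖L ξ‖ ≤ K) ∧
      ∀ ξ x, L ξ x = ∫ y in Ω, 𝐞 (-⟪y, ξ⟫_ℝ) • ((x y : ℝ) : ℂ) := by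
  let B : ℂ →L[ℝ] ℝ →L[ℝ] ℂ := (ContinuousLinearMap.lsmul ℝ ℝ).flip
  have hmem : ∀ ξ : EuclideanSpace ℝ (Fin N),
      MemLp (fun y => ((𝐞 (-⟪y, ξ⟫_ℝ) : Circle) : ℂ)) 2 (volume.restrict Ω) := by
    intro ξ
    refine MemLp.of_bound (C := 1) ?_ (ae_of_all _ fun y => (Circle.norm_coe _).le)
    refine Continuous.aestronglyMeasurable ?_
    fun_prop
  let P := ContinuousLinearMap.lpPairing (volume.restrict Ω) 2 2 B
  refine ⟨‖P‖ * (measureUnivNNReal (volume.restrict Ω) ^ (2 : ℝ≥0∞).toReal⁻¹ * 1),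
    fun ξ => P ((hmem ξ).toLp _), fun ξ => ?_, fun ξ x => ?_⟩
  · refine (P.le_opNorm _).trans ?_
    gcongr
    refine Lp.norm_le_of_ae_bound zero_le_one ?_
    filter_upwards [(hmem ξ).coeFn_toLp] with y hy
    rw [hy]
    exact (Circle.norm_coe _).le
  · simp only [P]
    rw [ContinuousLinearMap.lpPairing_eq_integral]
    refine integral_congr_ae ?_
    filter_upwards [(hmem ξ).coeFn_toLp] with y hy
    simp only [hy, B, ContinuousLinearMap.flip_apply, ContinuousLinearMap.lsmul_apply]
    rw [Circle.smul_def]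
    simp [mul_comm]

open scoped FourierTransform in
/-- The splitting into low and high frequencies, for elements of `testPairs Ω`. The continuity in
`ξ` supplies the measurability of the low frequency part. -/
theorem norm_sq_fst_le_of_mem_testPairs {N : ℕ} {Ω : Set (EuclideanSpace ℝ (Fin N))}
    {L : EuclideanSpace ℝ (Fin N) → (L2 Ω →L[ℝ] ℂ)}
    (hL : ∀ ξ x, L ξ x = ∫ y in Ω, 𝐞 (-⟪y, ξ⟫_ℝ) • ((x y : ℝ) : ℂ))
    {z : WithLp 2 (L2 Ω × L2Vec Ω)} (hz : z ∈ testPairs Ω) {R : ℝ} (hR : 0 < R) :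
    Continuous (fun ξ => L ξ z.fst) ∧
    ‖z.fst‖ ^ 2 ≤ (∫ ξ in Metric.ball 0 R, ‖L ξ z.fst‖ ^ 2) +
      ‖z.snd‖ ^ 2 / (2 * Real.pi * R) ^ 2 := by
  obtain ⟨φ, hφ, h1, h2⟩ := hz
  have h0 : ∀ x, x ∉ Ω → φ x = 0 := fun x hx =>
    image_eq_zero_of_notMem_tsupport fun h => hx (hφ.tsupport_subset h)
  have h0' : ∀ x, x ∉ Ω → gradient φ x = 0 := fun x hx => by
    have : fderiv ℝ φ x = 0 := by
      by_contra hne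
      exact hx (hφ.tsupport_subset (support_fderiv_subset ℝ hne))
    simp [gradient, this]
  have e1 : ‖z.fst‖ ^ 2 = ∫ x, φ x ^ 2 := by
    rw [L2_norm_sq_eq_integral h1, setIntegral_eq_integral_of_forall_compl_eq_zero
      fun x hx => by simp [h0 x hx]]
    simp
  have e2 : ‖z.snd‖ ^ 2 = ∫ x, ‖gradient φ x‖ ^ 2 := by
    rw [L2_norm_sq_eq_integral h2, setIntegral_eq_integral_of_forall_compl_eq_zero
      fun x hx => by simp [h0' x hx]]
  have e3 : (fun ξ => L ξ z.fst) = 𝓕 (fun x => (φ x : ℂ)) := by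
    funext ξ
    have : 𝓕 (fun x => (φ x : ℂ)) ξ = ∫ y in Ω, 𝐞 (-⟪y, ξ⟫_ℝ) • (φ y : ℂ) := by
      rw [Real.fourier_eq]
      exact (setIntegral_eq_integral_of_forall_compl_eq_zero fun x hx => by simp [h0 x hx]).symm
    rw [hL, this]
    refine integral_congr_ae ?_
    filter_upwards [h1] with y hy
    rw [hy]
  have := integral_sq_le_fourier_add_gradient hφ.contDiff hφ.hasCompactSupport hR
  rw [← e3, ← e1, ← e2] at this
  exact this

/-- Rellich's theorem for test functions. A weakly convergent subsequence, provided by the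
Banach–Alaoglu theorem, converges in norm. -/
theorem exists_subseq_cauchySeq_of_testPairs {N : ℕ} {Ω : Set (EuclideanSpace ℝ (Fin N))}
    [IsFiniteMeasure (volume.restrict Ω)]
    {z : ℕ → WithLp 2 (L2 Ω × L2Vec Ω)} (hz : ∀ n, z n ∈ testPairs Ω) {C : ℝ}
    (h1 : ∀ n, ‖(z n).fst‖ ≤ C) (h2 : ∀ n, ‖(z n).snd‖ ≤ C) :
    ∃ θ : ℕ → ℕ, StrictMono θ ∧ CauchySeq (fun n => (z (θ n)).fst) := by
  have : Fact ((2 : ℝ≥0∞) ≠ ⊤) := ⟨by norm_num⟩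
  obtain ⟨K, L, hK, hL⟩ := exists_fourier_functional Ω
  obtain ⟨a, -, θ, hθ, ha⟩ := WeakDual.isSeqCompact_closedBall ℝ (L2 Ω) 0 C
    (x := fun n => StrongDual.toWeakDual (InnerProductSpace.toDual ℝ (L2 Ω) (z n).fst))
    (fun n => by simpa using h1 n)
  refine ⟨θ, hθ, ?_⟩
  have hC : 0 ≤ C := (norm_nonneg _).trans (h1 0)
  have hK0 : 0 ≤ K := (norm_nonneg _).trans (hK 0)
  have hweak : ∀ y : L2 Ω, Tendsto (fun n => ⟪(z (θ n)).fst, y⟫_ℝ) atTop (𝓝 (a y)) := by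
    intro y
    exact ((WeakDual.eval_continuous y).tendsto a).comp ha
  have hreal : ∀ ℓ : L2 Ω →L[ℝ] ℝ, ∃ c, Tendsto (fun n => ℓ (z (θ n)).fst) atTop (𝓝 c) := by
    intro ℓ
    refine ⟨_, (hweak ((InnerProductSpace.toDual ℝ (L2 Ω)).symm ℓ)).congr fun n => ?_⟩
    rw [real_inner_comm, InnerProductSpace.toDual_symm_apply]
  have hconv : ∀ ξ, ∃ c : ℂ, Tendsto (fun n => L ξ (z (θ n)).fst) atTop (𝓝 c) := by
    intro ξ
    obtain ⟨c, hc⟩ := hreal (Complex.reCLM.comp (L ξ))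
    obtain ⟨d, hd⟩ := hreal (Complex.imCLM.comp (L ξ))
    refine ⟨c + d * Complex.I, ?_⟩
    have := ((Complex.continuous_ofReal.tendsto c).comp hc).add
      (((Complex.continuous_ofReal.tendsto d).comp hd).mul_const Complex.I)
    refine this.congr fun n => ?_
    simp [Complex.re_add_im]
  choose F hF using hconv
  -- low frequencies converge by dominated convergence, high ones are controlled by the gradient
  have key : ∀ R : ℝ, 0 < R → Tendsto (fun k : ℕ × ℕ =>
      ∫ ξ in Metric.ball (0 : EuclideanSpace ℝ (Fin N)) R,
        ‖L ξ ((z (θ k.1)).fst - (z (θ k.2)).fst)‖ ^ 2) (atTop ×ˢ atTop) (𝓝 0) := by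
    intro R hR
    rw [show (0 : ℝ) = ∫ ξ in Metric.ball (0 : EuclideanSpace ℝ (Fin N)) R, (0 : ℝ) by simp]
    have : IsFiniteMeasure (volume.restrict (Metric.ball (0 : EuclideanSpace ℝ (Fin N)) R)) :=
      ⟨by simpa using measure_ball_lt_top⟩
    refine tendsto_integral_filter_of_dominated_convergence (fun _ => (K * (2 * C)) ^ 2)
      (Eventually.of_forall fun k => ?_) (Eventually.of_forall fun k => ae_of_all _ fun ξ => ?_)
      (integrable_const _) (ae_of_all _ fun ξ => ?_)
    · have := (norm_sq_fst_le_of_mem_testPairs hL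
        ((testPairs Ω).sub_mem (hz (θ k.1)) (hz (θ k.2))) hR).1
      exact (this.norm.pow 2).aestronglyMeasurable
    · rw [Real.norm_of_nonneg (by positivity)]
      gcongr
      refine ((L ξ).le_opNorm _).trans ?_
      gcongr
      · exact hK ξ
      · refine (norm_sub_le _ _).trans ?_
        linarith [h1 (θ k.1), h1 (θ k.2)]
    · have ha' : Tendsto (fun k : ℕ × ℕ => L ξ (z (θ k.1)).fst) (atTop ×ˢ atTop) (𝓝 (F ξ)) :=
        (hF ξ).comp tendsto_fst
      have hb' : Tendsto (fun k : ℕ × ℕ => L ξ (z (θ k.2)).fst) (atTop ×ˢ atTop) (𝓝 (F ξ)) :=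
        (hF ξ).comp tendsto_snd
      have h' := (ha'.sub hb').norm.pow 2
      simpa [map_sub] using h'
  rw [Metric.cauchySeq_iff']
  intro ε hε
  obtain ⟨R, hR, hRε⟩ : ∃ R : ℝ, 0 < R ∧ (2 * C) ^ 2 / (2 * Real.pi * R) ^ 2 < ε ^ 2 / 2 := by
    have : Tendsto (fun R : ℝ => (2 * C) ^ 2 / (2 * Real.pi * R) ^ 2) atTop (𝓝 0) := by
      refine Tendsto.div_atTop tendsto_const_nhds ?_
      exact (tendsto_pow_atTop (by norm_num)).comp
        (tendsto_id.const_mul_atTop (by positivity))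
    obtain ⟨R, h, h'⟩ := ((this.eventually (gt_mem_nhds (by positivity : 0 < ε ^ 2 / 2))).and
      (eventually_gt_atTop 0)).exists
    exact ⟨R, h', h⟩
  have hev := (key R hR).eventually (gt_mem_nhds (by positivity : 0 < ε ^ 2 / 2))
  rw [prod_atTop_atTop_eq, eventually_atTop] at hev
  obtain ⟨⟨n₁, n₂⟩, hn⟩ := hev
  refine ⟨max n₁ n₂, fun n hge => ?_⟩
  have h3 := hn (n, max n₁ n₂) ⟨le_of_max_le_left hge, le_max_right _ _⟩
  have h4 := (norm_sq_fst_le_of_mem_testPairs hL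
    ((testPairs Ω).sub_mem (hz (θ n)) (hz (θ (max n₁ n₂)))) hR).2
  rw [WithLp.sub_fst, WithLp.sub_snd] at h4
  have h5 : ‖(z (θ n)).snd - (z (θ (max n₁ n₂))).snd‖ ≤ 2 * C :=
    (norm_sub_le _ _).trans (by linarith [h2 (θ n), h2 (θ (max n₁ n₂))])
  have h6 : ‖(z (θ n)).snd - (z (θ (max n₁ n₂))).snd‖ ^ 2 / (2 * Real.pi * R) ^ 2
      ≤ (2 * C) ^ 2 / (2 * Real.pi * R) ^ 2 := by gcongr
  rw [dist_eq_norm]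
  refine lt_of_pow_lt_pow_left₀ 2 hε.le ?_
  simp only at h3
  linarith

/-! ### The space `H¹₀(Ω)` and the Poincaré inequality -/

instance completeSpace_H10 {N : ℕ} (Ω : Set (EuclideanSpace ℝ (Fin N))) :
    CompleteSpace (H10 Ω) :=
  (Submodule.isClosed_topologicalClosure (testPairs Ω)).completeSpace_coe

section
variable {N : ℕ} {Ω : Set (EuclideanSpace ℝ (Fin N))}

theorem toL2_add (v w : H10 Ω) : toL2 (v + w) = toL2 v + toL2 w := rfl

theorem toL2_sub (v w : H10 Ω) : toL2 (v - w) = toL2 v - toL2 w := rfl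

theorem toL2_smul (c : ℝ) (v : H10 Ω) : toL2 (c • v) = c • toL2 v := rfl

theorem weakGrad_add (v w : H10 Ω) : weakGrad (v + w) = weakGrad v + weakGrad w := rfl

theorem weakGrad_sub (v w : H10 Ω) : weakGrad (v - w) = weakGrad v - weakGrad w := rfl

theorem weakGrad_smul (c : ℝ) (v : H10 Ω) : weakGrad (c • v) = c • weakGrad v := rfl

theorem norm_sq_H10 (v : H10 Ω) : ‖v‖ ^ 2 = ‖toL2 v‖ ^ 2 + ‖weakGrad v‖ ^ 2 := by
  have := WithLp.prod_norm_sq_eq_of_L2 (v : WithLp 2 (L2 Ω × L2Vec Ω))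
  exact this

theorem norm_toL2_le (v : H10 Ω) : ‖toL2 v‖ ≤ ‖v‖ := by
  refine (sq_le_sq₀ (norm_nonneg _) (norm_nonneg _)).1 ?_
  rw [norm_sq_H10]
  linarith [sq_nonneg ‖weakGrad v‖]

theorem norm_weakGrad_le (v : H10 Ω) : ‖weakGrad v‖ ≤ ‖v‖ := by
  refine (sq_le_sq₀ (norm_nonneg _) (norm_nonneg _)).1 ?_
  rw [norm_sq_H10]
  linarith [sq_nonneg ‖toL2 v‖]

/-- The embedding `H¹₀(Ω) ⊂ L²(Ω)` as a continuous linear map. -/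
noncomputable def toL2L (Ω : Set (EuclideanSpace ℝ (Fin N))) : H10 Ω →L[ℝ] L2 Ω :=
  LinearMap.mkContinuous
    { toFun := toL2, map_add' := toL2_add, map_smul' := toL2_smul } 1
    fun v => by simpa using norm_toL2_le v

/-- The weak gradient as a continuous linear map. -/
noncomputable def weakGradL (Ω : Set (EuclideanSpace ℝ (Fin N))) : H10 Ω →L[ℝ] L2Vec Ω :=
  LinearMap.mkContinuous
    { toFun := weakGrad, map_add' := weakGrad_add, map_smul' := weakGrad_smul } 1
    fun v => by simpa using norm_weakGrad_le v

@[simp] theorem toL2L_apply (v : H10 Ω) : toL2L Ω v = toL2 v := rfl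

theorem dirichletEigenvalue_nonneg {lam : ℝ} (h : IsDirichletEigenvalue Ω lam) : 0 ≤ lam := by
  obtain ⟨v, hv, h⟩ := h
  have h1 := h v
  rw [real_inner_self_eq_norm_sq, real_inner_self_eq_norm_sq] at h1
  by_contra hneg
  have h2 : ‖v‖ ^ 2 ≤ 0 := by
    have := sq_nonneg ‖weakGrad v‖
    have h3 : ‖toL2 v‖ ^ 2 = 0 := by
      by_contra hne
      have : 0 < ‖toL2 v‖ ^ 2 := lt_of_le_of_ne (sq_nonneg _) (Ne.symm hne)
      nlinarith
    rw [norm_sq_H10, h1, h3]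
    simp
  exact hv (by simpa using le_antisymm h2 (sq_nonneg _))

/-- A minimiser of the Rayleigh quotient is an eigenfunction. -/
theorem isDirichletEigenvalue_of_minimizer {Λ : ℝ}
    (hΛ : ∀ w : H10 Ω, Λ * ‖toL2 w‖ ^ 2 ≤ ‖weakGrad w‖ ^ 2) {v : H10 Ω} (hv : v ≠ 0)
    (hmin : ‖weakGrad v‖ ^ 2 = Λ * ‖toL2 v‖ ^ 2) : IsDirichletEigenvalue Ω Λ := by
  refine ⟨v, hv, fun w => ?_⟩
  -- `t ↦ |∇(v + t w)|² - Λ |v + t w|²` is nonnegative and vanishes at `0`, so it has no linear term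
  have h : ∀ t : ℝ, 0 ≤ (‖weakGrad w‖ ^ 2 - Λ * ‖toL2 w‖ ^ 2) * (t * t) +
      (2 * (⟪weakGrad v, weakGrad w⟫_ℝ - Λ * ⟪toL2 v, toL2 w⟫_ℝ)) * t + 0 := by
    intro t
    have := hΛ (v + t • w)
    rw [toL2_add, toL2_smul, weakGrad_add, weakGrad_smul, norm_add_sq_real, norm_add_sq_real,
      real_inner_smul_right, real_inner_smul_right, norm_smul, norm_smul, mul_pow, mul_pow,
      Real.norm_eq_abs, sq_abs] at this
    nlinarith
  have := discrim_le_zero h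
  rw [discrim] at this
  have h0 : (⟪weakGrad v, weakGrad w⟫_ℝ - Λ * ⟪toL2 v, toL2 w⟫_ℝ) ^ 2 = 0 :=
    le_antisymm (by linarith) (sq_nonneg _)
  exact sub_eq_zero.1 (by simpa using h0)

theorem exists_testPair_norm_sub_lt (v : H10 Ω) {ε : ℝ} (hε : 0 < ε) :
    ∃ z ∈ testPairs Ω, ‖z - (v : WithLp 2 (L2 Ω × L2Vec Ω))‖ < ε := by
  obtain ⟨z, hz, h⟩ := Metric.mem_closure_iff.1 v.2 ε hε
  exact ⟨z, hz, by rwa [dist_comm, dist_eq_norm] at h⟩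

/-- The compactness of the embedding `H¹₀(Ω) ⊂ L²(Ω)`. -/
theorem exists_subseq_cauchySeq_toL2 [IsFiniteMeasure (volume.restrict Ω)]
    {v : ℕ → H10 Ω} {C : ℝ} (hC : ∀ n, ‖v n‖ ≤ C) :
    ∃ θ : ℕ → ℕ, StrictMono θ ∧ CauchySeq (fun n => toL2 (v (θ n))) := by
  choose z hz hzv using fun n => exists_testPair_norm_sub_lt (v n)
    (show (0 : ℝ) < 1 / ((n : ℝ) + 1) by positivity)
  have hfst : ∀ x : WithLp 2 (L2 Ω × L2Vec Ω), ‖x.fst‖ ≤ ‖x‖ := fun x => by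
    refine (sq_le_sq₀ (norm_nonneg _) (norm_nonneg _)).1 ?_
    rw [WithLp.prod_norm_sq_eq_of_L2]
    linarith [sq_nonneg ‖x.snd‖]
  have hsnd : ∀ x : WithLp 2 (L2 Ω × L2Vec Ω), ‖x.snd‖ ≤ ‖x‖ := fun x => by
    refine (sq_le_sq₀ (norm_nonneg _) (norm_nonneg _)).1 ?_
    rw [WithLp.prod_norm_sq_eq_of_L2]
    linarith [sq_nonneg ‖x.fst‖]
  have hz' : ∀ n, ‖z n‖ ≤ C + 1 := fun n => by
    have h1 : ‖z n‖ ≤ ‖z n - v n‖ + ‖(v n : WithLp 2 (L2 Ω × L2Vec Ω))‖ := by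
      simpa using norm_add_le (z n - v n) (v n : WithLp 2 (L2 Ω × L2Vec Ω))
    have h2 : 1 / ((n : ℝ) + 1) ≤ 1 := by
      rw [div_le_one (by positivity)]
      linarith [n.cast_nonneg (α := ℝ)]
    have h3 : ‖(v n : WithLp 2 (L2 Ω × L2Vec Ω))‖ ≤ C := hC n
    linarith [hzv n]
  obtain ⟨θ, hθ, hc⟩ := exists_subseq_cauchySeq_of_testPairs hz
    (fun n => (hfst _).trans (hz' n)) (fun n => (hsnd _).trans (hz' n))
  refine ⟨θ, hθ, ?_⟩
  have h0 : Tendsto (fun n => toL2 (v (θ n)) - (z (θ n)).fst) atTop (𝓝 0) := by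
    have hlim : Tendsto (fun n => 1 / (((θ n : ℕ) : ℝ) + 1)) atTop (𝓝 0) :=
      tendsto_one_div_add_atTop_nhds_zero_nat.comp hθ.tendsto_atTop
    refine squeeze_zero_norm (fun n => ?_) hlim
    rw [norm_sub_rev]
    exact ((hfst (z (θ n) - v (θ n))).trans (hzv (θ n)).le)
  have := h0.cauchySeq.add hc
  simpa [Pi.add_def] using this

/-- The Poincaré inequality with the first eigenvalue as its constant. -/
theorem firstEigenvalue_mul_norm_sq_le [IsFiniteMeasure (volume.restrict Ω)] (v : H10 Ω) :
    firstEigenvalue Ω * ‖toL2 v‖ ^ 2 ≤ ‖weakGrad v‖ ^ 2 := by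
  by_cases hv : toL2 v = 0
  · rw [hv]
    simp
  set S : Set ℝ := {r | ∃ w : H10 Ω, ‖toL2 w‖ = 1 ∧ ‖weakGrad w‖ ^ 2 = r} with hS
  have hSb : BddBelow S := ⟨0, by rintro _ ⟨w, -, rfl⟩; positivity⟩
  have hnorm : ∀ w : H10 Ω, toL2 w ≠ 0 → ‖toL2 (‖toL2 w‖⁻¹ • w)‖ = 1 := fun w hw => by
    rw [toL2_smul, norm_smul, norm_inv, norm_norm, inv_mul_cancel₀ (norm_ne_zero_iff.2 hw)]
  have hSn : S.Nonempty := ⟨_, ‖toL2 v‖⁻¹ • v, hnorm v hv, rfl⟩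
  set Λ := sInf S with hΛdef
  have hΛ0 : 0 ≤ Λ := Real.sInf_nonneg (by rintro _ ⟨w, -, rfl⟩; positivity)
  have hΛ : ∀ w : H10 Ω, Λ * ‖toL2 w‖ ^ 2 ≤ ‖weakGrad w‖ ^ 2 := by
    intro w
    by_cases hw : toL2 w = 0
    · rw [hw]
      simp
    have h1 := csInf_le hSb (show ‖weakGrad (‖toL2 w‖⁻¹ • w)‖ ^ 2 ∈ S from ⟨_, hnorm w hw, rfl⟩)
    rw [weakGrad_smul, norm_smul, norm_inv, norm_norm, mul_pow, inv_pow] at h1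
    have hpos : 0 < ‖toL2 w‖ ^ 2 := pow_pos (norm_pos_iff.2 hw) 2
    calc Λ * ‖toL2 w‖ ^ 2 ≤ ((‖toL2 w‖ ^ 2)⁻¹ * ‖weakGrad w‖ ^ 2) * ‖toL2 w‖ ^ 2 := by gcongr
      _ = ‖weakGrad w‖ ^ 2 := by field_simp
  -- `firstEigenvalue Ω` is at most any eigenvalue, so it is enough that `Λ` is one
  suffices hE : IsDirichletEigenvalue Ω Λ by
    refine le_trans ?_ (hΛ v)
    gcongr
    exact csInf_le ⟨0, fun _ h => dirichletEigenvalue_nonneg h⟩ hE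
  have hmin : ∀ n : ℕ, ∃ w : H10 Ω, ‖toL2 w‖ = 1 ∧ ‖weakGrad w‖ ^ 2 < Λ + 1 / ((n : ℝ) + 1) := by
    intro n
    obtain ⟨_, ⟨w, hw, rfl⟩, h⟩ := exists_lt_of_csInf_lt hSn
      (show Λ < Λ + 1 / ((n : ℝ) + 1) by linarith [show (0 : ℝ) < 1 / ((n : ℝ) + 1) by positivity])
    exact ⟨w, hw, h⟩
  choose w hw1 hw2 using hmin
  have hbound : ∀ n, ‖w n‖ ≤ Λ + 2 := fun n => by
    have h2 : 1 / ((n : ℝ) + 1) ≤ 1 := by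
      rw [div_le_one (by positivity)]
      linarith [n.cast_nonneg (α := ℝ)]
    refine (sq_le_sq₀ (norm_nonneg _) (by positivity)).1 ?_
    rw [norm_sq_H10, hw1]
    nlinarith [hw2 n]
  obtain ⟨θ, hθ, hc⟩ := exists_subseq_cauchySeq_toL2 hbound
  have hlim : Tendsto (fun n => 1 / (((θ n : ℕ) : ℝ) + 1)) atTop (𝓝 0) :=
    tendsto_one_div_add_atTop_nhds_zero_nat.comp hθ.tendsto_atTop
  -- the parallelogram law turns convergence in `L²(Ω)` into convergence in `H¹₀(Ω)`
  have hpar : ∀ n k, ‖w (θ n) - w (θ k)‖ ^ 2 ≤ (1 + Λ) * ‖toL2 (w (θ n)) - toL2 (w (θ k))‖ ^ 2 +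
      (2 * (1 / (((θ n : ℕ) : ℝ) + 1)) + 2 * (1 / (((θ k : ℕ) : ℝ) + 1))) := by
    intro n k
    have p1 := parallelogram_law_with_norm ℝ (weakGrad (w (θ n))) (weakGrad (w (θ k)))
    have p2 := parallelogram_law_with_norm ℝ (toL2 (w (θ n))) (toL2 (w (θ k)))
    have p3 := hΛ (w (θ n) + w (θ k))
    rw [toL2_add, weakGrad_add] at p3
    rw [norm_sq_H10, toL2_sub, weakGrad_sub]
    rw [hw1, hw1] at p2
    nlinarith [hw2 (θ n), hw2 (θ k)]
  have hcau : CauchySeq (fun n => w (θ n)) := by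
    rw [cauchySeq_iff_tendsto_dist_atTop_0] at hc ⊢
    have h1 : Tendsto (fun k : ℕ × ℕ => ‖w (θ k.1) - w (θ k.2)‖ ^ 2) atTop (𝓝 0) := by
      have ht1 : Tendsto (fun k : ℕ × ℕ => 1 / (((θ k.1 : ℕ) : ℝ) + 1)) atTop (𝓝 0) := by
        rw [← prod_atTop_atTop_eq]
        exact hlim.comp tendsto_fst
      have ht2 : Tendsto (fun k : ℕ × ℕ => 1 / (((θ k.2 : ℕ) : ℝ) + 1)) atTop (𝓝 0) := by
        rw [← prod_atTop_atTop_eq]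
        exact hlim.comp tendsto_snd
      refine squeeze_zero (fun k => by positivity) (fun k => hpar k.1 k.2) ?_
      have := ((hc.pow 2).const_mul (1 + Λ)).add ((ht1.const_mul 2).add (ht2.const_mul 2))
      simpa [dist_eq_norm] using this
    have h2 := h1.sqrt
    simpa [dist_eq_norm] using h2
  obtain ⟨x, hx⟩ := cauchySeq_tendsto_of_complete hcau
  have hx1 : ‖toL2 x‖ = 1 := by
    have h1 := (((toL2L Ω).continuous.tendsto x).comp hx).norm
    refine tendsto_nhds_unique h1 ?_
    simp [hw1]
  have hx2 : ‖weakGrad x‖ ^ 2 ≤ Λ := by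
    have h1 := ((((weakGradL Ω).continuous.tendsto x).comp hx).norm).pow 2
    have h2 := hlim.const_add Λ
    rw [add_zero] at h2
    exact le_of_tendsto_of_tendsto' h1 h2 fun n => (hw2 (θ n)).le
  refine isDirichletEigenvalue_of_minimizer hΛ (v := x) ?_ ?_
  · rintro rfl
    have : toL2 (0 : H10 Ω) = 0 := rfl
    rw [this] at hx1
    simp at hx1
  · refine le_antisymm ?_ (hΛ x)
    rw [hx1]
    simpa using hx2

end

/-! ### Translations and Steklov averages in Bochner spaces -/

section
variable {E : Type*} [NormedAddCommGroup E]

/-- Translations act continuously on `L^p(ℝ; E)` for `p < ∞`. -/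
theorem continuous_translate_Lp {p : ℝ≥0∞} [Fact (1 ≤ p)] (hp : p ≠ ⊤)
    (f : Lp E p (volume : Measure ℝ)) :
    Continuous fun h : ℝ =>
      Lp.compMeasurePreserving (· + h) (measurePreserving_add_right volume h) f := by
  have hg : Continuous fun h : ℝ => (⟨(· + h), by fun_prop⟩ : C(ℝ, ℝ)) :=
    ContinuousMap.continuous_of_continuous_uncurry _ (by
      change Continuous fun x : ℝ × ℝ => x.2 + x.1
      fun_prop)
  exact Continuous.compMeasurePreservingLp (f := fun _ => f) continuous_const hg
    (fun h => measurePreserving_add_right volume h) hp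

end

/-- Hölder's inequality for the pairing of a curve of functionals with a curve of vectors. -/
theorem integrable_pairing {X α : Type*} [NormedAddCommGroup X] [NormedSpace ℝ X]
    [MeasurableSpace α] {μ : Measure α} {p q : ℝ≥0∞} [q.HolderConjugate p]
    {Γ : α → StrongDual ℝ X} {Z : α → X} (hΓ : MemLp Γ q μ) (hZ : MemLp Z p μ) :
    Integrable (fun r => Γ r (Z r)) μ :=
  memLp_one_iff_integrable.1
    ((ContinuousLinearMap.id ℝ (StrongDual ℝ X)).memLp_of_bilin 1 hΓ hZ)

theorem memLp_translate {F : Type*} [NormedAddCommGroup F] {f : ℝ → F} {p : ℝ≥0∞}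
    (hf : MemLp f p volume) (h : ℝ) : MemLp (fun r => f (r + h)) p volume :=
  hf.comp_measurePreserving (measurePreserving_add_right volume h)

section
variable {X : Type*} [NormedAddCommGroup X] [NormedSpace ℝ X]
  {p q : ℝ≥0∞} [Fact (1 ≤ p)] [Fact (1 ≤ q)] [q.HolderConjugate p]
  {Γ : ℝ → StrongDual ℝ X} {Z : ℝ → X}

/-- The `L¹` norm of the pairing, written with the bilinear map `L^q × L^p → L¹`, whose continuity
then turns continuity of translations into continuity of pairings. -/
theorem norm_holder_eq (hΓ : MemLp Γ q volume) (hZ : MemLp Z p volume) :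
    ‖(ContinuousLinearMap.id ℝ (StrongDual ℝ X)).holderL volume q p 1
      (hΓ.toLp Γ) (hZ.toLp Z)‖ = ∫ r, |Γ r (Z r)| := by
  rw [L1.norm_eq_integral_norm]
  refine integral_congr_ae ?_
  rw [ContinuousLinearMap.holderL_apply_apply]
  filter_upwards [ContinuousLinearMap.coeFn_holder (r := 1)
    (ContinuousLinearMap.id ℝ (StrongDual ℝ X))
    (hΓ.toLp Γ) (hZ.toLp Z), hΓ.coeFn_toLp, hZ.coeFn_toLp] with r h1 h2 h3
  rw [h1, h2, h3]
  rfl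

theorem norm_holder_sub_eq {Γ' : ℝ → StrongDual ℝ X} {Z' : ℝ → X}
    (hΓ : MemLp Γ q volume) (hZ : MemLp Z p volume)
    (hΓ' : MemLp Γ' q volume) (hZ' : MemLp Z' p volume) :
    ‖(ContinuousLinearMap.id ℝ (StrongDual ℝ X)).holderL volume q p 1
      (hΓ.toLp Γ) (hZ.toLp Z) - (ContinuousLinearMap.id ℝ (StrongDual ℝ X)).holderL volume q p 1
      (hΓ'.toLp Γ') (hZ'.toLp Z')‖ = ∫ r, |Γ r (Z r) - Γ' r (Z' r)| := by
  rw [L1.norm_eq_integral_norm]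
  refine integral_congr_ae ?_
  rw [ContinuousLinearMap.holderL_apply_apply, ContinuousLinearMap.holderL_apply_apply]
  filter_upwards [ContinuousLinearMap.coeFn_holder (r := 1)
    (ContinuousLinearMap.id ℝ (StrongDual ℝ X))
    (hΓ.toLp Γ) (hZ.toLp Z), hΓ.coeFn_toLp, hZ.coeFn_toLp,
    ContinuousLinearMap.coeFn_holder (r := 1) (ContinuousLinearMap.id ℝ (StrongDual ℝ X))
    (hΓ'.toLp Γ') (hZ'.toLp Z'), hΓ'.coeFn_toLp, hZ'.coeFn_toLp,
    Lp.coeFn_sub (ContinuousLinearMap.holder 1 (ContinuousLinearMap.id ℝ (StrongDual ℝ X))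
      (hΓ.toLp Γ) (hZ.toLp Z)) (ContinuousLinearMap.holder 1
      (ContinuousLinearMap.id ℝ (StrongDual ℝ X)) (hΓ'.toLp Γ') (hZ'.toLp Z'))]
    with r h1 h2 h3 h4 h5 h6 h7
  rw [h7, Pi.sub_apply, h1, h2, h3, h4, h5, h6]
  rfl

/-- The pairing of a translate of `Γ` with a translate of `Z` is continuous in `L¹(ℝ)`. -/
theorem tendsto_integral_abs_pairing_translate_sub (hp : p ≠ ⊤) (hq : q ≠ ⊤)
    (hΓ : MemLp Γ q volume) (hZ : MemLp Z p volume) :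
    Tendsto (fun h : ℝ × ℝ => ∫ r, |Γ (r + h.1) (Z (r + h.2)) - Γ r (Z r)|) (𝓝 0) (𝓝 0) := by
  let H := (ContinuousLinearMap.id ℝ (StrongDual ℝ X)).holderL (volume : Measure ℝ) q p 1
  let TΓ := fun h : ℝ => (memLp_translate hΓ h).toLp _
  let TZ := fun h : ℝ => (memLp_translate hZ h).toLp _
  have hTΓ : Continuous TΓ := continuous_translate_Lp hq (hΓ.toLp Γ)
  have hTZ : Continuous TZ := continuous_translate_Lp hp (hZ.toLp Z)
  have hc : Continuous fun h : ℝ × ℝ => ‖H (TΓ h.1) (TZ h.2) - H (TΓ 0) (TZ 0)‖ := by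
    fun_prop
  have h0 := hc.tendsto 0
  simp only [Prod.fst_zero, Prod.snd_zero, sub_self, norm_zero] at h0
  refine h0.congr fun h => ?_
  rw [norm_holder_sub_eq]
  simp

/-- The pairing of the increments of `Γ` and `Z` over steps of length `h` tends to `0` in `L¹(ℝ)`.
-/
theorem tendsto_integral_abs_pairing_increment (hp : p ≠ ⊤) (hq : q ≠ ⊤)
    (hΓ : MemLp Γ q volume) (hZ : MemLp Z p volume) :
    Tendsto (fun h : ℝ => ∫ r, |(Γ (r + h) - Γ r) (Z (r + h) - Z r)|) (𝓝 0) (𝓝 0) := by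
  let H := (ContinuousLinearMap.id ℝ (StrongDual ℝ X)).holderL (volume : Measure ℝ) q p 1
  let TΓ := fun h : ℝ => (memLp_translate hΓ h).toLp _
  let TZ := fun h : ℝ => (memLp_translate hZ h).toLp _
  have hTΓ : Continuous TΓ := continuous_translate_Lp hq (hΓ.toLp Γ)
  have hTZ : Continuous TZ := continuous_translate_Lp hp (hZ.toLp Z)
  have hc : Continuous fun h : ℝ => ‖H (TΓ h - hΓ.toLp Γ) (TZ h - hZ.toLp Z)‖ := by
    fun_prop
  have h0 := hc.tendsto 0
  have e1 : TΓ 0 = hΓ.toLp Γ := by simp [TΓ]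
  have e2 : TZ 0 = hZ.toLp Z := by simp [TZ]
  simp only [e1, e2, sub_self, map_zero, norm_zero] at h0
  refine h0.congr fun h => ?_
  exact norm_holder_eq ((memLp_translate hΓ h).sub hΓ) ((memLp_translate hZ h).sub hZ)

theorem intervalIntegral_dual_apply (hΓ : MemLp Γ q volume) (r k : ℝ) (x : X) :
    (∫ ρ in r..(r + k), Γ ρ) x = ∫ σ in (0 : ℝ)..k, Γ (r + σ) x := by
  have hint : IntervalIntegrable Γ volume r (r + k) :=
    ((hΓ.locallyIntegrable Fact.out).integrableOn_isCompact isCompact_uIcc).intervalIntegrable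
  rw [ContinuousLinearMap.intervalIntegral_apply hint,
    intervalIntegral.integral_comp_add_left (fun ρ => Γ ρ x)]
  simp

/-- Integrability on the rectangle `(s, t] × (0, k]`, so that Fubini's theorem applies to Steklov
averages `∫_r^{r+k} Γ = ∫_0^k Γ(r + σ) dσ` paired with `Z(r)`. -/
theorem integrable_prod_pairing_translate (hΓ : MemLp Γ q volume) (hZ : MemLp Z p volume)
    (s t k : ℝ) :
    Integrable (fun y : ℝ × ℝ => Γ (y.1 + y.2) (Z y.1))
      ((volume.restrict (Ioc s t)).prod (volume.restrict (Ioc 0 k))) := by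
  have hΓm : AEStronglyMeasurable (fun y : ℝ × ℝ => Γ (y.1 + y.2)) (volume.prod volume) :=
    hΓ.1.comp_quasiMeasurePreserving (quasiMeasurePreserving_add volume volume)
  have hm : AEStronglyMeasurable (fun y : ℝ × ℝ => Γ (y.1 + y.2) (Z y.1))
      ((volume.restrict (Ioc s t)).prod (volume.restrict (Ioc 0 k))) := by
    rw [Measure.prod_restrict]
    exact ((ContinuousLinearMap.id ℝ (StrongDual ℝ X)).aestronglyMeasurable_comp₂ hΓm
      hZ.1.comp_fst).mono_measure Measure.restrict_le_self
  have hint : ∀ σ, Integrable (fun r => Γ (r + σ) (Z r)) :=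
    fun σ => integrable_pairing (memLp_translate hΓ σ) hZ
  rw [integrable_prod_iff' hm]
  refine ⟨ae_of_all _ fun σ => (hint σ).integrableOn, ?_⟩
  let H := (ContinuousLinearMap.id ℝ (StrongDual ℝ X)).holderL (volume : Measure ℝ) q p 1
  refine Integrable.mono' (integrable_const (‖H‖ * ‖hΓ.toLp Γ‖ * ‖hZ.toLp Z‖))
    (hm.norm.prod_swap.integral_prod_right') (ae_of_all _ fun σ => ?_)
  rw [Real.norm_of_nonneg (integral_nonneg fun _ => norm_nonneg _)]
  refine (setIntegral_le_integral (hint σ).norm (ae_of_all _ fun r => norm_nonneg _)).trans ?_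
  have h1 := norm_holder_eq (memLp_translate hΓ σ) hZ
  have h2 : ‖(memLp_translate hΓ σ).toLp _‖ = ‖hΓ.toLp Γ‖ :=
    Lp.norm_compMeasurePreserving (hΓ.toLp Γ) (measurePreserving_add_right volume σ)
  refine h1.symm.le.trans ?_
  rw [← h2]
  exact H.le_opNorm₂ _ _

theorem intervalIntegrable_steklov_pairing (hΓ : MemLp Γ q volume) (hZ : MemLp Z p volume)
    {s t k : ℝ} (hst : s ≤ t) (hk : 0 ≤ k) :
    IntervalIntegrable (fun r => (∫ ρ in r..(r + k), Γ ρ) (Z r)) volume s t := by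
  rw [intervalIntegrable_iff_integrableOn_Ioc_of_le hst]
  refine (integrable_prod_pairing_translate hΓ hZ s t k).integral_prod_left.congr
    (ae_of_all _ fun r => ?_)
  simp only
  rw [intervalIntegral_dual_apply hΓ, intervalIntegral.integral_of_le hk]

theorem integral_steklov_pairing_eq (hΓ : MemLp Γ q volume) (hZ : MemLp Z p volume)
    {s t k : ℝ} (hst : s ≤ t) (hk : 0 ≤ k) :
    ∫ r in s..t, (∫ ρ in r..(r + k), Γ ρ) (Z r) =
      ∫ σ in (0 : ℝ)..k, ∫ r in s..t, Γ (r + σ) (Z r) := by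
  simp_rw [intervalIntegral_dual_apply hΓ]
  simp_rw [intervalIntegral.integral_of_le hst, intervalIntegral.integral_of_le hk]
  exact integral_integral_swap (integrable_prod_pairing_translate hΓ hZ s t k)

/-- The Steklov averages `k⁻¹ ∫_r^{r+k} Γ`, paired with `Z(r + k) + Z(r)`, converge to `2 ⟨Γ, Z⟩` in
integrated form as `k ↓ 0`. -/
theorem tendsto_steklov_pairing (hp : p ≠ ⊤) (hq : q ≠ ⊤)
    (hΓ : MemLp Γ q volume) (hZ : MemLp Z p volume) {s t : ℝ} (hst : s ≤ t) :
    Tendsto (fun k => k⁻¹ * ∫ r in s..t, (∫ ρ in r..(r + k), Γ ρ) (Z (r + k) + Z r)) (𝓝[>] 0)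
      (𝓝 (2 * ∫ r in s..t, Γ r (Z r))) := by
  have hT := tendsto_integral_abs_pairing_translate_sub hp hq hΓ hZ
  rw [Metric.tendsto_nhds_nhds] at hT
  rw [Metric.tendsto_nhdsWithin_nhds]
  intro ε hε
  obtain ⟨δ, hδ, hd⟩ := hT (ε / 4) (by positivity)
  refine ⟨δ, hδ, fun k hk hkδ => ?_⟩
  have hk0 : 0 < k := hk
  have hkδ' : k < δ := by simpa [Real.dist_eq, abs_of_pos hk0] using hkδ
  have hZk : MemLp (fun r => Z (r + k) + Z r) p volume := (memLp_translate hZ k).add hZ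
  rw [integral_steklov_pairing_eq hΓ hZk hst hk0.le]
  set J : ℝ := ∫ r in s..t, Γ r (Z r) with hJ
  -- each fixed shift `σ ≤ k` moves the pairing by little
  have hnear : ∀ σ ∈ Ioc 0 k,
      ‖(∫ r in s..t, Γ (r + σ) (Z (r + k) + Z r)) - 2 * J‖ ≤ ε / 2 := by
    intro σ hσ
    have d1 := @hd (σ, k) (by
      rw [dist_zero_right, Prod.norm_def, max_lt_iff]
      simp only [Real.norm_eq_abs, abs_of_pos hσ.1, abs_of_pos hk0]
      exact ⟨hσ.2.trans_lt hkδ', hkδ'⟩)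
    have d2 := @hd (σ, 0) (by
      rw [dist_zero_right, Prod.norm_def, max_lt_iff]
      simp only [Real.norm_eq_abs, abs_of_pos hσ.1, abs_zero]
      exact ⟨hσ.2.trans_lt hkδ', hδ⟩)
    rw [Real.dist_eq, sub_zero, abs_of_nonneg (integral_nonneg fun _ => abs_nonneg _)] at d1 d2
    simp only [add_zero] at d1 d2
    have i0 := integrable_pairing hΓ hZ
    have i1 := integrable_pairing (memLp_translate hΓ σ) (memLp_translate hZ k)
    have i2 := integrable_pairing (memLp_translate hΓ σ) hZ
    have hle : ∀ {g : ℝ → ℝ}, Integrable g → |∫ r in s..t, g r| ≤ ∫ r, |g r| := by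
      intro g hg
      refine (intervalIntegral.abs_integral_le_integral_abs hst).trans ?_
      rw [intervalIntegral.integral_of_le hst]
      exact setIntegral_le_integral hg.abs (ae_of_all _ fun _ => abs_nonneg _)
    have e1 : (∫ r in s..t, Γ (r + σ) (Z (r + k) + Z r)) - 2 * J =
        (∫ r in s..t, (Γ (r + σ) (Z (r + k)) - Γ r (Z r))) +
        ∫ r in s..t, (Γ (r + σ) (Z r) - Γ r (Z r)) := by
      simp_rw [map_add]
      rw [intervalIntegral.integral_add i1.intervalIntegrable i2.intervalIntegrable,
        intervalIntegral.integral_sub i1.intervalIntegrable i0.intervalIntegrable,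
        intervalIntegral.integral_sub i2.intervalIntegrable i0.intervalIntegrable, hJ]
      ring
    rw [e1]
    refine (norm_add_le _ _).trans ?_
    have := hle (i1.sub i0)
    have := hle (i2.sub i0)
    simp only [Real.norm_eq_abs, Pi.sub_apply] at *
    linarith
  have hJint : IntervalIntegrable (fun σ => ∫ r in s..t, Γ (r + σ) (Z (r + k) + Z r))
      volume 0 k := by
    rw [intervalIntegrable_iff_integrableOn_Ioc_of_le hk0.le]
    simp_rw [intervalIntegral.integral_of_le hst]
    exact (integrable_prod_pairing_translate hΓ hZk s t k).integral_prod_right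
  have hmain := intervalIntegral.norm_integral_le_of_norm_le_const (a := 0) (b := k)
    (f := fun σ => (∫ r in s..t, Γ (r + σ) (Z (r + k) + Z r)) - 2 * J) (C := ε / 2)
    (fun σ hσ => hnear σ (by rwa [uIoc_of_le hk0.le] at hσ))
  rw [intervalIntegral.integral_sub hJint intervalIntegrable_const,
    intervalIntegral.integral_const, sub_zero, abs_of_pos hk0, smul_eq_mul] at hmain
  rw [Real.dist_eq]
  set A := ∫ σ in (0 : ℝ)..k, ∫ r in s..t, Γ (r + σ) (Z (r + k) + Z r)
  have : k⁻¹ * A - 2 * J = k⁻¹ * (A - k * (2 * J)) := by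
    field_simp
  rw [this, abs_mul, abs_of_pos (inv_pos.2 hk0)]
  calc k⁻¹ * |A - k * (2 * J)| ≤ k⁻¹ * (ε / 2 * k) := by
        gcongr
        exact hmain
    _ = ε / 2 := by field_simp
    _ < ε := by linarith

end

/-! ### The energy identity between Lebesgue points -/

/-- If the increments of `E` over steps of length `k` are given by pairing `∫_r^{r+k} Γᵢ` with
`Zᵢ(r+k) + Zᵢ(r)`, then `E' = 2 ∑ ⟨Γᵢ, Zᵢ⟩` in integrated form, between Lebesgue points of `E`. -/
theorem exists_energy_identity {X₁ X₂ : Type*} [NormedAddCommGroup X₁] [NormedSpace ℝ X₁]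
    [NormedAddCommGroup X₂] [NormedSpace ℝ X₂] {p₁ q₁ p₂ q₂ : ℝ≥0∞} [Fact (1 ≤ p₁)]
    [Fact (1 ≤ q₁)] [q₁.HolderConjugate p₁] [Fact (1 ≤ p₂)] [Fact (1 ≤ q₂)]
    [q₂.HolderConjugate p₂] (hp₁ : p₁ ≠ ⊤) (hq₁ : q₁ ≠ ⊤) (hp₂ : p₂ ≠ ⊤) (hq₂ : q₂ ≠ ⊤)
    {Γ₁ : ℝ → StrongDual ℝ X₁} {Z₁ : ℝ → X₁} {Γ₂ : ℝ → StrongDual ℝ X₂} {Z₂ : ℝ → X₂}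
    (hΓ₁ : MemLp Γ₁ q₁ volume) (hZ₁ : MemLp Z₁ p₁ volume) (hΓ₂ : MemLp Γ₂ q₂ volume)
    (hZ₂ : MemLp Z₂ p₂ volume) {E : ℝ → ℝ} (hE : LocallyIntegrable E volume) {α β : ℝ}
    (hinc : ∀ k > 0, ∀ᵐ r, α < r → r + k < β → E (r + k) - E r =
      (∫ ρ in r..(r + k), Γ₁ ρ) (Z₁ (r + k) + Z₁ r) +
      (∫ ρ in r..(r + k), Γ₂ ρ) (Z₂ (r + k) + Z₂ r)) :
    ∃ S : Set ℝ, (∀ᵐ t, t ∈ S) ∧ ∀ s ∈ S, ∀ t ∈ S, α < s → s ≤ t → t < β →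
      E t - E s = 2 * ∫ r in s..t, (Γ₁ r (Z₁ r) + Γ₂ r (Z₂ r)) := by
  refine ⟨{x | ∀ c, HasDerivAt (fun x => ∫ (t : ℝ) in c..x, E t) (E x) x},
    LocallyIntegrable.ae_hasDerivAt_integral hE, fun s hs t ht hαs hst htβ => ?_⟩
  have hEi : ∀ a b, IntervalIntegrable E volume a b := fun a b =>
    (hE.integrableOn_isCompact isCompact_uIcc).intervalIntegrable
  -- both sides are limits, as `k ↓ 0`, of `k⁻¹ ∫_s^t (E(r + k) - E(r)) dr`
  have l1 := ((ht 0).tendsto_slope_zero_right).sub ((hs 0).tendsto_slope_zero_right)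
  have l2 := (tendsto_steklov_pairing hp₁ hq₁ hΓ₁ hZ₁ hst).add
    (tendsto_steklov_pairing hp₂ hq₂ hΓ₂ hZ₂ hst)
  rw [intervalIntegral.integral_add (integrable_pairing hΓ₁ hZ₁).intervalIntegrable
    (integrable_pairing hΓ₂ hZ₂).intervalIntegrable, mul_add]
  refine tendsto_nhds_unique_of_eventuallyEq l1 l2 ?_
  have hk : ∀ᶠ k : ℝ in 𝓝[>] 0, 0 < k ∧ k < β - t :=
    Ioo_mem_nhdsGT (by linarith)
  filter_upwards [hk] with k ⟨hk0, hkβ⟩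
  have hsh : IntervalIntegrable (fun r => E (r + k)) volume s t := by
    have := (hEi (s + k) (t + k)).comp_add_right k
    simpa using this
  have e1 : (∫ r in (0 : ℝ)..(t + k), E r) - (∫ r in (0 : ℝ)..t, E r) -
      ((∫ r in (0 : ℝ)..(s + k), E r) - ∫ r in (0 : ℝ)..s, E r) =
      ∫ r in s..t, (E (r + k) - E r) := by
    rw [intervalIntegral.integral_sub hsh (hEi s t), intervalIntegral.integral_comp_add_right,
      ← intervalIntegral.integral_interval_sub_left (hEi 0 (t + k)) (hEi 0 (s + k)),
      ← intervalIntegral.integral_interval_sub_left (hEi 0 t) (hEi 0 s)]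
    ring
  have e2 : ∫ r in s..t, (E (r + k) - E r) =
      (∫ r in s..t, (∫ ρ in r..(r + k), Γ₁ ρ) (Z₁ (r + k) + Z₁ r)) +
      ∫ r in s..t, (∫ ρ in r..(r + k), Γ₂ ρ) (Z₂ (r + k) + Z₂ r) := by
    refine Eq.trans ?_ (intervalIntegral.integral_add
      (intervalIntegrable_steklov_pairing hΓ₁ ((memLp_translate hZ₁ k).add hZ₁) hst hk0.le)
      (intervalIntegrable_steklov_pairing hΓ₂ ((memLp_translate hZ₂ k).add hZ₂) hst hk0.le))
    refine intervalIntegral.integral_congr_ae ?_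
    filter_upwards [hinc k hk0] with r hr hr'
    rw [uIoc_of_le hst] at hr'
    exact hr (hαs.trans hr'.1) (by linarith [hr'.2])
  rw [smul_eq_mul, smul_eq_mul, ← mul_sub, e1, e2, mul_add]

/-! ### Weak evolutions -/

/-- Limits from the right outside a null set of times are unique. -/
theorem neBot_nhdsGT_inf_ae (s : ℝ) : (𝓝[>] s ⊓ ae (volume : Measure ℝ)).NeBot := by
  rw [Filter.inf_neBot_iff]
  intro U hU V hV
  obtain ⟨b, hb, hbU⟩ := mem_nhdsGT_iff_exists_Ioo_subset.1 hU
  by_contra hne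
  rw [not_nonempty_iff_eq_empty] at hne
  have h1 : Ioo s b ⊆ Vᶜ := fun x hx hxV => by
    have : x ∈ U ∩ V := ⟨hbU hx, hxV⟩
    rw [hne] at this
    exact this
  have h2 : volume (Ioo s b) = 0 := measure_mono_null h1 (mem_ae_iff.1 hV)
  rw [Real.volume_Ioo, ENNReal.ofReal_eq_zero] at h2
  have hb' : s < b := hb
  linarith

theorem eventually_nhdsGT_inf_ae_mem {τ : ℝ} {G : Set ℝ} (h : ∀ᵐ t, τ < t → t ∈ G) {s : ℝ}
    (hs : τ ≤ s) : ∀ᶠ t in 𝓝[>] s ⊓ ae (volume : Measure ℝ), t ∈ G := by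
  have h1 : ∀ᶠ t in 𝓝[>] s ⊓ ae (volume : Measure ℝ), s < t :=
    (eventually_mem_nhdsWithin (s := Ioi s)).filter_mono inf_le_left
  have h2 := h.filter_mono (inf_le_right (a := 𝓝[>] s))
  filter_upwards [h1, h2] with t ht1 ht2
  exact ht2 (hs.trans_lt ht1)

/-- `z` is a curve in `H` on `(τ, ∞)` with `z' = Γ₁ + Γ₂` and `z(τ) = z₀`, both in the weak form
tested against the values of `z` itself and against a dense set of vectors. The functionals `Γᵢ(t)`
act on normed spaces `Xᵢ`, and `Zᵢ` stands for `z` as a curve in `Xᵢ`. The set `G` holds the times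
at which the identities are valid. -/
structure IsWeakEvolution {H X₁ X₂ : Type*} [NormedAddCommGroup H] [InnerProductSpace ℝ H]
    [NormedAddCommGroup X₁] [NormedSpace ℝ X₁] [NormedAddCommGroup X₂] [NormedSpace ℝ X₂]
    (p q : ℝ≥0∞) (τ : ℝ) (z₀ : H) (G : Set ℝ) (z : ℝ → H)
    (Γ₁ : ℝ → StrongDual ℝ X₁) (Z₁ : ℝ → X₁) (Γ₂ : ℝ → StrongDual ℝ X₂) (Z₂ : ℝ → X₂) : Prop where
  ae_mem : ∀ᵐ t, τ < t → t ∈ G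
  subset_Ioi : G ⊆ Ioi τ
  memLp_z : ∀ T, τ < T → MemLp z 2 (volume.restrict (Ioo τ T))
  memLp_Γ₁ : ∀ T, τ < T → MemLp Γ₁ 2 (volume.restrict (Ioo τ T))
  memLp_Z₁ : ∀ T, τ < T → MemLp Z₁ 2 (volume.restrict (Ioo τ T))
  memLp_Γ₂ : ∀ T, τ < T → MemLp Γ₂ q (volume.restrict (Ioo τ T))
  memLp_Z₂ : ∀ T, τ < T → MemLp Z₂ p (volume.restrict (Ioo τ T))
  inner_sub : ∀ t ∈ G, ∀ s ∈ G,
    ⟪z t - z₀, z s⟫_ℝ = (∫ r in τ..t, Γ₁ r) (Z₁ s) + (∫ r in τ..t, Γ₂ r) (Z₂ s)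
  exists_dense : ∃ D : Set H, Dense D ∧ ∀ v ∈ D, ∃ φ : ℝ → ℝ, ContinuousOn φ (Ici τ) ∧ φ τ = 0 ∧
    ∀ t ∈ G, ⟪z t, v⟫_ℝ = ⟪z₀, v⟫_ℝ + φ t

theorem integral_translate_sub {F : Type*} [NormedAddCommGroup F] [NormedSpace ℝ F] {g : ℝ → F}
    {q : ℝ≥0∞} [Fact (1 ≤ q)] (hg : MemLp g q volume) (a b h : ℝ) :
    ∫ r in a..b, (g (r + h) - g r) = (∫ r in (a + h)..(b + h), g r) - ∫ r in a..b, g r := by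
  have hl : ∀ {f : ℝ → F}, MemLp f q volume → IntervalIntegrable f volume a b :=
    fun hf => ((hf.locallyIntegrable Fact.out).integrableOn_isCompact
      isCompact_uIcc).intervalIntegrable
  rw [intervalIntegral.integral_sub (hl (memLp_translate hg h)) (hl hg),
    intervalIntegral.integral_comp_add_right]

theorem norm_sq_sub_norm_sq_eq_inner {H : Type*} [NormedAddCommGroup H] [InnerProductSpace ℝ H]
    (x y : H) : ‖x‖ ^ 2 - ‖y‖ ^ 2 = ⟪x - y, x + y⟫_ℝ := by
  rw [inner_sub_left, inner_add_right, inner_add_right, real_inner_self_eq_norm_sq,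
    real_inner_self_eq_norm_sq, real_inner_comm x y]
  ring

namespace IsWeakEvolution

variable {H X₁ X₂ : Type*} [NormedAddCommGroup H] [InnerProductSpace ℝ H]
    [NormedAddCommGroup X₁] [NormedSpace ℝ X₁] [NormedAddCommGroup X₂] [NormedSpace ℝ X₂]
    {p q : ℝ≥0∞} [Fact (1 ≤ q)] {τ : ℝ} {z₀ : H} {G : Set ℝ} {z : ℝ → H}
    {Γ₁ : ℝ → StrongDual ℝ X₁} {Z₁ : ℝ → X₁} {Γ₂ : ℝ → StrongDual ℝ X₂} {Z₂ : ℝ → X₂}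

theorem integral_indicator_eq {F : Type*} [NormedAddCommGroup F] [NormedSpace ℝ F] (g : ℝ → F)
    {T a b : ℝ} (ha : τ < a) (hab : a ≤ b) (hb : b < T) :
    ∫ r in a..b, (Ioo τ T).indicator g r = ∫ r in a..b, g r := by
  refine intervalIntegral.integral_congr fun r hr => ?_
  rw [uIcc_of_le hab] at hr
  exact indicator_of_mem (s := Ioo τ T) ⟨ha.trans_le hr.1, hr.2.trans_lt hb⟩ g

theorem intervalIntegrable_of_memLp {F : Type*} [NormedAddCommGroup F] {g : ℝ → F}
    (hg : ∀ T, τ < T → MemLp g q (volume.restrict (Ioo τ T))) {t : ℝ} (ht : τ ≤ t) :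
    IntervalIntegrable g volume τ t := by
  rw [intervalIntegrable_iff_integrableOn_Ioc_of_le ht]
  have : IntegrableOn g (Ioo τ (t + 1)) := (hg (t + 1) (by linarith)).integrable Fact.out
  exact this.mono_set fun x hx => ⟨hx.1, hx.2.trans_lt (by linarith)⟩

/-- The weak identity between two times, with `Γᵢ` cut off to `(τ, T)` so that it is defined and
integrable on the whole line. -/
theorem inner_increment (h : IsWeakEvolution p q τ z₀ G z Γ₁ Z₁ Γ₂ Z₂) {T r₁ r₂ x : ℝ}
    (h₁ : r₁ ∈ G) (h₂ : r₂ ∈ G) (hx : x ∈ G) (h12 : r₁ ≤ r₂) (hT : r₂ < T) :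
    ⟪z r₂ - z r₁, z x⟫_ℝ = (∫ r in r₁..r₂, (Ioo τ T).indicator Γ₁ r) (Z₁ x) +
      (∫ r in r₁..r₂, (Ioo τ T).indicator Γ₂ r) (Z₂ x) := by
  have g₁ : τ < r₁ := h.subset_Ioi h₁
  have g₂ : τ < r₂ := h.subset_Ioi h₂
  rw [integral_indicator_eq _ g₁ h12 hT, integral_indicator_eq _ g₁ h12 hT,
    ← intervalIntegral.integral_interval_sub_left
      (intervalIntegrable_of_memLp h.memLp_Γ₁ g₂.le) (intervalIntegrable_of_memLp h.memLp_Γ₁ g₁.le),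
    ← intervalIntegral.integral_interval_sub_left
      (intervalIntegrable_of_memLp h.memLp_Γ₂ g₂.le) (intervalIntegrable_of_memLp h.memLp_Γ₂ g₁.le),
    show z r₂ - z r₁ = (z r₂ - z₀) - (z r₁ - z₀) by abel, inner_sub_left, h.inner_sub r₂ h₂ x hx,
    h.inner_sub r₁ h₁ x hx]
  simp only [_root_.sub_apply]
  ring

theorem ae_translate_mem (h : ∀ᵐ t, τ < t → t ∈ G) (c : ℝ) : ∀ᵐ t, τ < t + c → t + c ∈ G :=
  (measurePreserving_add_right volume c).quasiMeasurePreserving.ae h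

theorem memLp_indicator {F : Type*} [NormedAddCommGroup F] {g : ℝ → F} {p : ℝ≥0∞} {T : ℝ}
    (hg : MemLp g p (volume.restrict (Ioo τ T))) : MemLp ((Ioo τ T).indicator g) p volume :=
  (memLp_indicator_iff_restrict measurableSet_Ioo).2 hg

variable [Fact (1 ≤ p)] [q.HolderConjugate p]

/-- The increments of `z` over steps of length `h` are small, uniformly in time: their squared norm
satisfies the energy identity, in which the right-hand side is small by the continuity of
translations, and so is their mean over time. -/
theorem exists_modulus (hp : p ≠ ⊤) (hq : q ≠ ⊤)
    (hz : IsWeakEvolution p q τ z₀ G z Γ₁ Z₁ Γ₂ Z₂) {T : ℝ} (hT : τ < T) :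
    ∃ ϑ : ℝ → ℝ, Tendsto ϑ (𝓝 0) (𝓝 0) ∧ ∀ h, 0 < h → h < (T - τ) / 2 →
      ∀ᵐ t, τ < t → t + h < T → ‖z (t + h) - z t‖ ^ 2 ≤ ϑ h := by
  set ℓ := (T - τ) / 2 with hℓ
  have hℓ0 : 0 < ℓ := by rw [hℓ]; linarith
  set I := Ioo τ T with hI
  have mz := memLp_indicator (hz.memLp_z T hT)
  have mΓ₁ := memLp_indicator (hz.memLp_Γ₁ T hT)
  have mZ₁ := memLp_indicator (hz.memLp_Z₁ T hT)
  have mΓ₂ := memLp_indicator (hz.memLp_Γ₂ T hT)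
  have mZ₂ := memLp_indicator (hz.memLp_Z₂ T hT)
  set z' := I.indicator z with hz'
  set Γ₁' := I.indicator Γ₁ with hΓ₁'
  set Γ₂' := I.indicator Γ₂ with hΓ₂'
  set Z₁' := I.indicator Z₁ with hZ₁'
  set Z₂' := I.indicator Z₂ with hZ₂'
  -- by the energy identity for `z(· + h) - z`, its squared norm varies in time by at most `2 δ h`
  let δ : ℝ → ℝ := fun h => (∫ r, |(Γ₁' (r + h) - Γ₁' r) (Z₁' (r + h) - Z₁' r)|) +
    ∫ r, |(Γ₂' (r + h) - Γ₂' r) (Z₂' (r + h) - Z₂' r)|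
  have hδ : Tendsto δ (𝓝 0) (𝓝 0) := by
    have := (tendsto_integral_abs_pairing_increment (by norm_num) (by norm_num) mΓ₁ mZ₁).add
      (tendsto_integral_abs_pairing_increment hp hq mΓ₂ mZ₂)
    rwa [add_zero] at this
  have hm : Tendsto (fun h => ∫ r, ‖z' (r + h) - z' r‖ ^ 2) (𝓝 0) (𝓝 0) := by
    have minner : MemLp (fun r => innerSL ℝ (z' r)) 2 volume :=
      (innerSL ℝ (E := H)).comp_memLp' mz
    refine (tendsto_integral_abs_pairing_increment (by norm_num) (by norm_num) minner mz).congr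
      fun h => integral_congr_ae (ae_of_all _ fun r => ?_)
    simp only
    rw [← map_sub, innerSL_apply_apply, real_inner_self_eq_norm_sq, abs_of_nonneg (by positivity)]
  refine ⟨fun h => ℓ⁻¹ * (∫ r, ‖z' (r + h) - z' r‖ ^ 2) + 2 * δ h, ?_, fun h hh0 hhℓ => ?_⟩
  · have := (hm.const_mul ℓ⁻¹).add (hδ.const_mul 2)
    simpa using this
  set E : ℝ → ℝ := fun r => ‖z' (r + h) - z' r‖ ^ 2 with hE
  have mzh : MemLp (fun r => z' (r + h) - z' r) 2 volume := (memLp_translate mz h).sub mz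
  have mΓ₁h : MemLp (fun r => Γ₁' (r + h) - Γ₁' r) 2 volume := (memLp_translate mΓ₁ h).sub mΓ₁
  have mZ₁h : MemLp (fun r => Z₁' (r + h) - Z₁' r) 2 volume := (memLp_translate mZ₁ h).sub mZ₁
  have mΓ₂h : MemLp (fun r => Γ₂' (r + h) - Γ₂' r) q volume := (memLp_translate mΓ₂ h).sub mΓ₂
  have mZ₂h : MemLp (fun r => Z₂' (r + h) - Z₂' r) p volume := (memLp_translate mZ₂ h).sub mZ₂
  have hEint : Integrable E := mzh.integrable_norm_pow (by norm_num)
  have hmemI : ∀ {x}, x ∈ G → x < T → x ∈ I := fun hx hxT => ⟨hz.subset_Ioi hx, hxT⟩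
  -- the increment `z(· + h) - z` is again a weak evolution, driven by the increments of `Γᵢ`
  have hinc : ∀ k > 0, ∀ᵐ r, τ < r → r + k < T - h → E (r + k) - E r =
      (∫ ρ in r..(r + k), (Γ₁' (ρ + h) - Γ₁' ρ))
        ((Z₁' (r + k + h) - Z₁' (r + k)) + (Z₁' (r + h) - Z₁' r)) +
      (∫ ρ in r..(r + k), (Γ₂' (ρ + h) - Γ₂' ρ))
        ((Z₂' (r + k + h) - Z₂' (r + k)) + (Z₂' (r + h) - Z₂' r)) := by
    intro k hk
    filter_upwards [hz.ae_mem, ae_translate_mem hz.ae_mem k, ae_translate_mem hz.ae_mem h,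
      ae_translate_mem hz.ae_mem (k + h)] with r g0 g1 g2 g3 hτr hrT
    replace g0 := g0 hτr
    replace g1 := g1 (by linarith)
    replace g2 := g2 (by linarith)
    replace g3 := g3 (by linarith)
    rw [← add_assoc] at g3
    have i0 := hmemI g0 (by linarith)
    have i1 := hmemI g1 (by linarith)
    have i2 := hmemI g2 (by linarith)
    have i3 := hmemI g3 (by linarith)
    have key : ∀ x ∈ G, ⟪(z (r + k + h) - z (r + k)) - (z (r + h) - z r), z x⟫_ℝ =
        (∫ ρ in r..(r + k), (Γ₁' (ρ + h) - Γ₁' ρ)) (Z₁ x) +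
        (∫ ρ in r..(r + k), (Γ₂' (ρ + h) - Γ₂' ρ)) (Z₂ x) := by
      intro x hx
      rw [integral_translate_sub mΓ₁, integral_translate_sub mΓ₂,
        show (z (r + k + h) - z (r + k)) - (z (r + h) - z r) =
          (z (r + k + h) - z (r + h)) - (z (r + k) - z r) by abel, inner_sub_left,
        hz.inner_increment g2 g3 hx (by linarith) i3.2,
        hz.inner_increment g0 g1 hx (by linarith) i1.2]
      simp only [_root_.sub_apply]
      ring
    simp only [hE, hz', hZ₁', hZ₂', indicator_of_mem i0, indicator_of_mem i1, indicator_of_mem i2,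
      indicator_of_mem i3]
    rw [norm_sq_sub_norm_sq_eq_inner]
    simp only [inner_add_right, inner_sub_right, key _ g0, key _ g1, key _ g2, key _ g3, map_add,
      map_sub]
    ring
  obtain ⟨S, hS, hSE⟩ := exists_energy_identity (by norm_num) (by norm_num) hp hq mΓ₁h mZ₁h mΓ₂h
    mZ₂h hEint.locallyIntegrable hinc
  have hle : ∀ {g : ℝ → ℝ} {s t : ℝ}, s ≤ t → Integrable g → |∫ r in s..t, g r| ≤ ∫ r, |g r| := by
    intro g s t hst hg
    refine (intervalIntegral.abs_integral_le_integral_abs hst).trans ?_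
    rw [intervalIntegral.integral_of_le hst]
    exact setIntegral_le_integral hg.abs (ae_of_all _ fun _ => abs_nonneg _)
  have hdiff : ∀ s ∈ S, ∀ t ∈ S, τ < s → s ≤ t → t < T - h → |E t - E s| ≤ 2 * δ h := by
    intro s hs t ht hτs hst htT
    have j1 := integrable_pairing mΓ₁h mZ₁h
    have j2 := integrable_pairing mΓ₂h mZ₂h
    rw [hSE s hs t ht hτs hst htT, intervalIntegral.integral_add j1.intervalIntegrable
      j2.intervalIntegrable, abs_mul, abs_two]
    gcongr
    exact (abs_add_le _ _).trans (add_le_add (hle hst j1) (hle hst j2))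
  filter_upwards [hS, hz.ae_mem, ae_translate_mem hz.ae_mem h] with t htS g0 g1 hτt htT
  have i0 := hmemI (g0 hτt) (by linarith)
  have i1 := hmemI (g1 (by linarith)) htT
  have hEt : E t = ‖z (t + h) - z t‖ ^ 2 := by
    simp only [hE, hz', indicator_of_mem i0, indicator_of_mem i1]
  rw [← hEt]
  -- comparison of `E t` with its mean over an interval of length `ℓ`, where `s + h < T` as `h < ℓ`
  have hEs : ∀ᵐ s ∂(volume.restrict (Ioc τ (τ + ℓ))), E t - 2 * δ h ≤ E s := by
    rw [ae_restrict_iff' measurableSet_Ioc]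
    have hne : ∀ᵐ s : ℝ, s ≠ τ + ℓ := by simp [ae_iff, measure_singleton]
    filter_upwards [hS, hne] with s hsS hne hs
    have hsT : s < T - h := by
      have := lt_of_le_of_ne hs.2 hne
      linarith
    rcases le_total s t with hst | hst
    · linarith [le_abs_self (E t - E s), hdiff s hsS t htS hs.1 hst (by linarith)]
    · linarith [neg_abs_le (E s - E t), hdiff t htS s hsS hτt hst hsT]
  have hint := integral_mono_ae (integrable_const (E t - 2 * δ h))
    (hEint.integrableOn (s := Ioc τ (τ + ℓ))) hEs
  rw [setIntegral_const, Real.volume_real_Ioc_of_le (by linarith), add_sub_cancel_left,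
    smul_eq_mul] at hint
  have hint2 : ℓ * (E t - 2 * δ h) ≤ ∫ r, E r :=
    hint.trans (setIntegral_le_integral hEint (ae_of_all _ fun r => by positivity))
  have hfin : E t - 2 * δ h ≤ ℓ⁻¹ * ∫ r, E r := by
    rw [inv_mul_eq_div, le_div_iff₀ hℓ0]
    linarith
  linarith

end IsWeakEvolution

namespace IsWeakEvolution

variable {H X₁ X₂ : Type*} [NormedAddCommGroup H] [InnerProductSpace ℝ H]
    [NormedAddCommGroup X₁] [NormedSpace ℝ X₁] [NormedAddCommGroup X₂] [NormedSpace ℝ X₂]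
    {p q : ℝ≥0∞} [q.HolderConjugate p]
    {τ : ℝ} {z₀ : H} {G : Set ℝ} {z : ℝ → H}
    {Γ₁ : ℝ → StrongDual ℝ X₁} {Z₁ : ℝ → X₁} {Γ₂ : ℝ → StrongDual ℝ X₂} {Z₂ : ℝ → X₂}

/-- `G ∪ {τ}` is dense in `[τ, ∞)`. -/
theorem mem_closure_insert (h : ∀ᵐ t, τ < t → t ∈ G) : Ici τ ⊆ closure (insert τ G) := by
  intro x hx
  have := neBot_nhdsGT_inf_ae x
  refine closure_mono (subset_insert τ G) (mem_closure_iff_frequently.2 ?_)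
  have h1 : ∃ᶠ t in 𝓝[>] x ⊓ ae (volume : Measure ℝ), t ∈ G :=
    (eventually_nhdsGT_inf_ae_mem h hx).frequently
  exact h1.filter_mono (inf_le_left.trans nhdsWithin_le_nhds)

theorem intervalIntegrable_pairing (hz : IsWeakEvolution p q τ z₀ G z Γ₁ Z₁ Γ₂ Z₂) {t : ℝ}
    (ht : τ ≤ t) : IntervalIntegrable (fun r => Γ₁ r (Z₁ r) + Γ₂ r (Z₂ r)) volume τ t := by
  rw [intervalIntegrable_iff_integrableOn_Ioc_of_le ht]
  have hT : τ < t + 1 := by linarith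
  have h1 := integrable_pairing (hz.memLp_Γ₁ _ hT) (hz.memLp_Z₁ _ hT)
  have h2 := integrable_pairing (hz.memLp_Γ₂ _ hT) (hz.memLp_Z₂ _ hT)
  have : IntegrableOn (fun r => Γ₁ r (Z₁ r) + Γ₂ r (Z₂ r)) (Ioo τ (t + 1)) := h1.add h2
  exact this.mono_set fun x hx => ⟨hx.1, hx.2.trans_lt (by linarith)⟩

variable [Fact (1 ≤ q)] [Fact (1 ≤ p)]

/-- The bound on increments, valid for almost every time, extends to all times in `G` and to the
initial time, because `z` is weakly continuous on `G ∪ {τ}` when it is given the value `z₀` at `τ`.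
-/
theorem exists_modulus_update (hp : p ≠ ⊤) (hq : q ≠ ⊤)
    (hz : IsWeakEvolution p q τ z₀ G z Γ₁ Z₁ Γ₂ Z₂) {T : ℝ} (hT : τ < T) :
    ∃ ϑ : ℝ → ℝ, Tendsto ϑ (𝓝 0) (𝓝 0) ∧ ∀ s ∈ insert τ G, ∀ t ∈ insert τ G, s < t → t < T →
      t - s < (T - τ) / 2 →
      ‖Function.update z τ z₀ t - Function.update z τ z₀ s‖ ≤ ϑ (t - s) := by
  obtain ⟨ϑ, hϑ, hle⟩ := hz.exists_modulus hp hq hT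
  obtain ⟨D, hD, hDφ⟩ := hz.exists_dense
  have h1 := hϑ.sqrt
  rw [Real.sqrt_zero] at h1
  refine ⟨fun h => √(ϑ h), h1, fun s hs t ht hst htT hℓ => ?_⟩
  have hτs : τ ≤ s := by
    rcases hs with rfl | hs
    · exact le_rfl
    · exact (hz.subset_Ioi hs).le
  set y := Function.update z τ z₀ t - Function.update z τ z₀ s with hy
  set c := √(ϑ (t - s)) with hc
  have hc0 : 0 ≤ c := Real.sqrt_nonneg _
  have hrep : ∀ {φ : ℝ → ℝ} {v : H}, φ τ = 0 → (∀ r ∈ G, ⟪z r, v⟫_ℝ = ⟪z₀, v⟫_ℝ + φ r) →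
      ∀ r ∈ insert τ G, ⟪Function.update z τ z₀ r, v⟫_ℝ = ⟪z₀, v⟫_ℝ + φ r := by
    intro φ v h0 hr r hrG
    rcases hrG with rfl | hrG
    · simp [h0]
    · rw [Function.update_of_ne (hz.subset_Ioi hrG).ne', hr r hrG]
  have hDle : ∀ v ∈ D, ⟪y, v⟫_ℝ ≤ c * ‖v‖ := by
    intro v hv
    obtain ⟨φ, hφ, hφ0, hφz⟩ := hDφ v hv
    have e1 : ⟪y, v⟫_ℝ = φ t - φ s := by
      rw [hy, inner_sub_left, hrep hφ0 hφz t ht, hrep hφ0 hφz s hs]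
      ring
    rw [e1]
    have := neBot_nhdsGT_inf_ae s
    -- `r ↓ s` through times at which the bound on the increment over the step `t - s` is known
    have ht1 : Tendsto (fun r => φ (r + (t - s)) - φ r) (𝓝[>] s ⊓ ae volume) (𝓝 (φ t - φ s)) := by
      refine Tendsto.mono_left ?_ inf_le_left
      have c1 : Tendsto φ (𝓝[>] s) (𝓝 (φ s)) :=
        (hφ s hτs).mono_left (nhdsWithin_mono _ fun x hx => hτs.trans (le_of_lt hx))
      have c2 : Tendsto (fun r => φ (r + (t - s))) (𝓝[>] s) (𝓝 (φ t)) := by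
        refine (hφ t (hτs.trans hst.le)).tendsto.comp (tendsto_nhdsWithin_iff.2 ⟨?_, ?_⟩)
        · have : Tendsto (fun r => r + (t - s)) (𝓝 s) (𝓝 (s + (t - s))) :=
            tendsto_id.add_const _
          rw [add_sub_cancel] at this
          exact this.mono_left nhdsWithin_le_nhds
        · filter_upwards [self_mem_nhdsWithin] with r hr
          have : s < r := hr
          change τ ≤ r + (t - s)
          linarith
      exact c2.sub c1
    refine le_of_tendsto ht1 ?_
    have hlt : ∀ᶠ r in 𝓝[>] s ⊓ ae volume, s < r ∧ r < T - (t - s) := by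
      have : Ioo s (T - (t - s)) ∈ 𝓝[>] s := Ioo_mem_nhdsGT (by linarith)
      exact mem_inf_of_left this
    filter_upwards [hlt, eventually_nhdsGT_inf_ae_mem hz.ae_mem hτs,
      (ae_translate_mem hz.ae_mem (t - s)).filter_mono inf_le_right,
      (hle (t - s) (by linarith) hℓ).filter_mono inf_le_right] with r hr g0 g1 hb
    replace g1 := g1 (by linarith)
    replace hb := hb (by linarith) (by linarith)
    have hb' : ‖z (r + (t - s)) - z r‖ ≤ c := Real.le_sqrt_of_sq_le hb
    have e2 : φ (r + (t - s)) - φ r = ⟪z (r + (t - s)) - z r, v⟫_ℝ := by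
      rw [inner_sub_left, hφz _ g0, hφz _ g1]
      ring
    rw [e2]
    refine (real_inner_le_norm _ _).trans ?_
    gcongr
  have hall : ∀ v : H, ⟪y, v⟫_ℝ ≤ c * ‖v‖ := by
    intro v
    have hcl : IsClosed {v : H | ⟪y, v⟫_ℝ ≤ c * ‖v‖} :=
      isClosed_le (by fun_prop) (by fun_prop)
    exact hcl.closure_subset_iff.2 hDle (hD v)
  have hyy := hall y
  rw [real_inner_self_eq_norm_sq] at hyy
  rcases (norm_nonneg y).eq_or_lt with h0 | h0
  · rw [← h0]
    exact hc0
  · nlinarith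

/-- A weak evolution has a continuous representative with the initial value `z₀`. The bound on
increments makes `z`, with the value `z₀` at `τ`, Cauchy along `G ∪ {τ}` at every time. -/
theorem exists_continuousOn (hp : p ≠ ⊤) (hq : q ≠ ⊤) [CompleteSpace H]
    (hz : IsWeakEvolution p q τ z₀ G z Γ₁ Z₁ Γ₂ Z₂) :
    ∃ w : ℝ → H, ContinuousOn w (Ici τ) ∧ w τ = z₀ ∧ ∀ t ∈ G, w t = z t := by
  set y := Function.update z τ z₀ with hy
  set A := insert τ G with hA
  have hcl := mem_closure_insert hz.ae_mem
  have hlim : ∀ x ∈ Ici τ, ∃ l, Tendsto y (𝓝[A] x) (𝓝 l) := by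
    intro x hx
    have hx' : τ ≤ x := hx
    have : (𝓝[A] x).NeBot := mem_closure_iff_nhdsWithin_neBot.1 (hcl hx)
    refine CompleteSpace.complete (f := map y (𝓝[A] x)) ?_
    obtain ⟨ϑ, hϑ, hle⟩ := hz.exists_modulus_update hp hq (T := x + 1) (by linarith)
    rw [Metric.cauchy_iff]
    refine ⟨inferInstance, fun ε hε => ?_⟩
    obtain ⟨δ, hδ, hδε⟩ := Metric.tendsto_nhds_nhds.1 hϑ ε hε
    set ρ := min (δ / 2) (min (1 / 8) 1) with hρ
    have hρ0 : 0 < ρ := by positivity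
    have hρ1 : ρ ≤ δ / 2 := min_le_left _ _
    have hρ2 : ρ ≤ 1 / 8 := (min_le_right _ _).trans (min_le_left _ _)
    refine ⟨y '' (Metric.ball x ρ ∩ A), image_mem_map
      (inter_comm A _ ▸ inter_mem_nhdsWithin A (Metric.ball_mem_nhds x hρ0)), ?_⟩
    have hord : ∀ s ∈ Metric.ball x ρ ∩ A, ∀ t ∈ Metric.ball x ρ ∩ A, s < t →
        dist (y t) (y s) < ε := by
      rintro s ⟨hs, hsA⟩ t ⟨ht, htA⟩ hst
      rw [Metric.mem_ball, Real.dist_eq, abs_lt] at hs ht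
      rw [dist_eq_norm]
      refine (hle s hsA t htA hst (by linarith) (by linarith)).trans_lt ?_
      have := hδε (x := t - s) (by
        rw [Real.dist_eq, sub_zero, abs_of_pos (by linarith)]
        linarith)
      rw [Real.dist_eq, sub_zero] at this
      exact (le_abs_self _).trans_lt this
    rintro _ ⟨s, hs, rfl⟩ _ ⟨t, ht, rfl⟩
    rcases lt_trichotomy s t with h | h | h
    · rw [dist_comm]
      exact hord s hs t ht h
    · rw [h, dist_self]
      exact hε
    · exact hord t ht s hs h
  have heq : ∀ x ∈ A, x ∈ Ici τ → extendFrom A y x = y x := by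
    intro x hxA hx
    obtain ⟨l, hl⟩ := hlim x hx
    have h1 : Tendsto y (pure x) (𝓝 l) := hl.mono_left (pure_le_nhdsWithin hxA)
    have h2 : l = y x := tendsto_nhds_unique h1 (tendsto_pure_nhds y x)
    rw [← h2]
    exact extendFrom_eq (hcl hx) hl
  refine ⟨extendFrom A y, continuousOn_extendFrom hcl hlim, ?_, fun t ht => ?_⟩
  · rw [heq τ (mem_insert _ _) self_mem_Ici, hy, Function.update_self]
  · have : τ < t := hz.subset_Ioi ht
    rw [heq t (mem_insert_of_mem _ ht) this.le, hy, Function.update_of_ne this.ne']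

/-- The energy equality for the continuous representative. It holds between Lebesgue points of
`‖z‖²`, and extends to all times by continuity of both sides. -/
theorem norm_sq_sub_norm_sq (hp : p ≠ ⊤) (hq : q ≠ ⊤)
    (hz : IsWeakEvolution p q τ z₀ G z Γ₁ Z₁ Γ₂ Z₂) {w : ℝ → H} (hw : ContinuousOn w (Ici τ))
    (hwz : ∀ t ∈ G, w t = z t) {t : ℝ} (ht : τ ≤ t) :
    ‖w t‖ ^ 2 - ‖w τ‖ ^ 2 = 2 * ∫ r in τ..t, (Γ₁ r (Z₁ r) + Γ₂ r (Z₂ r)) := by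
  set T := t + 1 with hTdef
  have hT : τ < T := by linarith
  have mz := memLp_indicator (hz.memLp_z T hT)
  have mΓ₁ := memLp_indicator (hz.memLp_Γ₁ T hT)
  have mZ₁ := memLp_indicator (hz.memLp_Z₁ T hT)
  have mΓ₂ := memLp_indicator (hz.memLp_Γ₂ T hT)
  have mZ₂ := memLp_indicator (hz.memLp_Z₂ T hT)
  have hmemI : ∀ {x}, x ∈ G → x < T → x ∈ Ioo τ T := fun hx hxT => ⟨hz.subset_Ioi hx, hxT⟩
  have hEint : Integrable (fun r => ‖(Ioo τ T).indicator z r‖ ^ 2) :=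
    mz.integrable_norm_pow (by norm_num)
  obtain ⟨S, hS, hSE⟩ := exists_energy_identity (α := τ) (β := T) (by norm_num) (by norm_num) hp hq
    mΓ₁ mZ₁ mΓ₂ mZ₂ hEint.locallyIntegrable (by
      intro k hk
      filter_upwards [hz.ae_mem, ae_translate_mem hz.ae_mem k] with r g0 g1 hτr hrT
      replace g0 := g0 hτr
      replace g1 := g1 (by linarith)
      have i0 := hmemI g0 (by linarith)
      have i1 := hmemI g1 (by linarith)
      simp only [indicator_of_mem i0, indicator_of_mem i1]
      rw [norm_sq_sub_norm_sq_eq_inner]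
      simp only [inner_add_right, hz.inner_increment g0 g1 g0 (by linarith) i1.2,
        hz.inner_increment g0 g1 g1 (by linarith) i1.2, map_add]
      ring)
  set F : ℝ → ℝ := fun t => ‖w t‖ ^ 2 - 2 * ∫ r in τ..t, (Γ₁ r (Z₁ r) + Γ₂ r (Z₂ r)) with hF
  have hprim : ContinuousOn (fun t => ∫ r in τ..t, (Γ₁ r (Z₁ r) + Γ₂ r (Z₂ r))) (Icc τ T) := by
    have := intervalIntegral.continuousOn_primitive_interval
      (intervalIntegrable_iff_integrableOn_Icc_of_le hT.le |>.1
        (hz.intervalIntegrable_pairing hT.le) |> fun h => (uIcc_of_le hT.le).symm ▸ h)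
    rwa [uIcc_of_le hT.le] at this
  have hFc : ContinuousOn F (Icc τ T) :=
    ((hw.mono Icc_subset_Ici_self).norm.pow 2).sub (hprim.const_mul 2)
  have hFeq : ∀ s ∈ S ∩ G, ∀ x ∈ S ∩ G, s ≤ x → x < T → F x = F s := by
    rintro s ⟨hsS, hsG⟩ x ⟨hxS, hxG⟩ hsx hxT
    have hτs : τ < s := hz.subset_Ioi hsG
    have h1 := hSE s hsS x hxS hτs hsx hxT
    rw [indicator_of_mem (hmemI hxG hxT), indicator_of_mem (hmemI hsG (by linarith))] at h1
    have h2 : ∫ r in s..x, ((Ioo τ T).indicator Γ₁ r ((Ioo τ T).indicator Z₁ r) +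
        (Ioo τ T).indicator Γ₂ r ((Ioo τ T).indicator Z₂ r)) =
        ∫ r in s..x, (Γ₁ r (Z₁ r) + Γ₂ r (Z₂ r)) := by
      refine intervalIntegral.integral_congr fun r hr => ?_
      rw [uIcc_of_le hsx] at hr
      have hr' : r ∈ Ioo τ T := ⟨hτs.trans_le hr.1, hr.2.trans_lt hxT⟩
      simp only [indicator_of_mem hr']
    rw [h2, ← intervalIntegral.integral_interval_sub_left
      (hz.intervalIntegrable_pairing (hτs.le.trans hsx))
      (hz.intervalIntegrable_pairing hτs.le)] at h1
    simp only [hF, hwz s hsG, hwz x hxG]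
    linarith
  have hSG : ∀ᵐ r, τ < r → r ∈ S ∩ G := by
    filter_upwards [hS, hz.ae_mem] with r h1 h2 h3 using ⟨h1, h2 h3⟩
  have hFconst : ∀ s ∈ S ∩ G, ∀ x, τ ≤ x → x < T → s < T → F x = F s := by
    intro s hs x hτx hxT hsT
    have := neBot_nhdsGT_inf_ae x
    have hFx : Tendsto F (𝓝[>] x ⊓ ae volume) (𝓝 (F x)) := by
      have h1 : Tendsto F (𝓝[Icc τ T] x) (𝓝 (F x)) := hFc x ⟨hτx, hxT.le⟩
      refine h1.mono_left (inf_le_left.trans ?_)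
      rw [← nhdsWithin_Ioo_eq_nhdsGT hxT]
      exact nhdsWithin_mono _ fun r hr => ⟨hτx.trans hr.1.le, hr.2.le⟩
    refine tendsto_nhds_unique (hFx.congr' ?_) tendsto_const_nhds
    have hlt : ∀ᶠ r in 𝓝[>] x ⊓ ae volume, r < T := by
      have : Ioo x T ∈ 𝓝[>] x := Ioo_mem_nhdsGT hxT
      exact (mem_inf_of_left this : Ioo x T ∈ _) |> fun h => by
        filter_upwards [h] with r hr using hr.2
    filter_upwards [hlt, eventually_nhdsGT_inf_ae_mem hSG hτx] with r hr hrS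
    rcases le_total s r with h | h
    · exact hFeq s hs r hrS h hr
    · exact (hFeq r hrS s hs h hsT).symm
  have := neBot_nhdsGT_inf_ae τ
  obtain ⟨s, hs, hsT⟩ : ∃ s, s ∈ S ∩ G ∧ s < T := by
    have hlt : Ioo τ T ∈ 𝓝[>] τ ⊓ ae volume := mem_inf_of_left (Ioo_mem_nhdsGT hT)
    obtain ⟨s, hs, hs'⟩ := ((eventually_nhdsGT_inf_ae_mem hSG le_rfl).and hlt).exists
    exact ⟨s, hs, hs'.2⟩
  have e1 := hFconst s hs t ht (by linarith) hsT
  have e2 := hFconst s hs τ le_rfl hT hsT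
  simp only [hF, intervalIntegral.integral_same, mul_zero, sub_zero] at e1 e2
  linarith

end IsWeakEvolution

/-! ### Nemytskii operators between Lebesgue spaces -/

/-- In a separable space every open set is a countable union of balls, so a map is measurable as
soon as its distance to each point is. -/
theorem measurable_of_measurable_edist {α Y : Type*} [MeasurableSpace α] [PseudoEMetricSpace Y]
    [SecondCountableTopology Y] [MeasurableSpace Y] [BorelSpace Y] {f : α → Y}
    (h : ∀ y, Measurable fun a => edist (f a) y) : Measurable f := by
  refine measurable_of_isOpen fun U hU => ?_
  choose! ε hε hεU using EMetric.isOpen_iff.1 hU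
  obtain ⟨T, hT, hTU⟩ := TopologicalSpace.isOpen_iUnion_countable
    (fun y : U => Metric.eball (y : Y) (ε y)) fun y => Metric.isOpen_eball
  have hUeq : U = ⋃ y ∈ T, Metric.eball (y : Y) (ε y) := by
    rw [hTU]
    refine Subset.antisymm (fun x hx => mem_iUnion.2 ⟨⟨x, hx⟩, Metric.mem_eball_self (hε x hx)⟩) ?_
    exact iUnion_subset fun y => hεU y y.2
  rw [hUeq, preimage_iUnion₂]
  refine MeasurableSet.biUnion hT fun y _ => ?_
  exact measurableSet_lt (h y) measurable_const

section
variable {β : Type*} [MeasurableSpace β] {μ : Measure β} {f : ℝ → ℝ} {r : ℝ≥0∞}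

/-- By Fatou's lemma `w ↦ ‖f(w) - y‖_{L^r}` is lower semicontinuous on `L²`. -/
theorem lowerSemicontinuous_eLpNorm_comp_sub (hf : Continuous f) {y : β → ℝ}
    (hy : AEStronglyMeasurable y μ) :
    LowerSemicontinuous fun w : Lp ℝ 2 μ => eLpNorm (fun x => f (w x) - y x) r μ := by
  rw [lowerSemicontinuous_iff_isClosed_preimage]
  intro c
  refine IsSeqClosed.isClosed fun w w₀ hw hlim => ?_
  obtain ⟨θ, -, hae⟩ := (tendstoInMeasure_of_tendsto_Lp hlim).exists_seq_tendsto_ae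
  have hm : ∀ v : Lp ℝ 2 μ, AEStronglyMeasurable (fun x => f (v x) - y x) μ := fun v =>
    (hf.comp_aestronglyMeasurable (Lp.aestronglyMeasurable v)).sub hy
  have h1 := Lp.eLpNorm_lim_le_liminf_eLpNorm (p := r)
    (f := fun n x => f (w (θ n) x) - y x) (fun n => hm _) (fun x => f (w₀ x) - y x) (by
      filter_upwards [hae] with x hx
      exact ((hf.tendsto _).comp hx).sub_const _)
  refine h1.trans ?_
  exact (liminf_le_liminf (Eventually.of_forall fun n => hw (θ n))).trans (by simp)

open scoped Classical in
/-- The Nemytskii operator `w ↦ f ∘ w` from `L²` to `L^r`, with value `0` at those `w` for which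
`f ∘ w` is not in `L^r`. -/
noncomputable def nemytskii (f : ℝ → ℝ) (r : ℝ≥0∞) (w : Lp ℝ 2 μ) : Lp ℝ r μ :=
  if h : MemLp (fun x => f (w x)) r μ then h.toLp _ else 0

theorem coeFn_nemytskii {w : Lp ℝ 2 μ} (h : MemLp (fun x => f (w x)) r μ) :
    nemytskii f r w =ᵐ[μ] fun x => f (w x) := by
  rw [nemytskii, dif_pos h]
  exact h.coeFn_toLp

theorem enorm_nemytskii_le [Fact (1 ≤ r)] (w : Lp ℝ 2 μ) :
    ‖nemytskii f r w‖ₑ ≤ eLpNorm (fun x => f (w x)) r μ := by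
  rw [nemytskii]
  split_ifs with h
  · rw [Lp.enorm_toLp]
  · simp

/-- The Nemytskii operator is Borel measurable, because its distance to any point of `L^r` is a
lower semicontinuous function on `L²`. -/
theorem aestronglyMeasurable_nemytskii [Fact (1 ≤ r)] [SecondCountableTopology (Lp ℝ r μ)]
    (hf : Continuous f) {α : Type*} [MeasurableSpace α] {ν : Measure α} {u : α → Lp ℝ 2 μ}
    (hu : AEStronglyMeasurable u ν) :
    AEStronglyMeasurable (fun t => (nemytskii f r (u t) : Lp ℝ r μ)) ν := by
  borelize ↥(Lp ℝ 2 μ)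
  borelize ↥(Lp ℝ r μ)
  have hm : ∀ v : Lp ℝ 2 μ, AEStronglyMeasurable (fun x => f (v x)) μ := fun v =>
    hf.comp_aestronglyMeasurable (Lp.aestronglyMeasurable v)
  have hset : MeasurableSet {w : Lp ℝ 2 μ | MemLp (fun x => f (w x)) r μ} := by
    have h0 : Measurable fun w : Lp ℝ 2 μ => eLpNorm (fun x => f (w x)) r μ := by
      simpa using (lowerSemicontinuous_eLpNorm_comp_sub (r := r) (μ := μ) hf (y := fun _ => 0)
        aestronglyMeasurable_const).measurable
    have : {w : Lp ℝ 2 μ | MemLp (fun x => f (w x)) r μ} =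
        {w : Lp ℝ 2 μ | eLpNorm (fun x => f (w x)) r μ < ⊤} := by
      ext w
      exact ⟨fun h => h.2, fun h => ⟨hm w, h⟩⟩
    rw [this]
    exact measurableSet_lt h0 measurable_const
  have hmeas : Measurable (nemytskii f r : Lp ℝ 2 μ → Lp ℝ r μ) := by
    refine measurable_of_measurable_edist fun y => ?_
    have h1 := (lowerSemicontinuous_eLpNorm_comp_sub (r := r) hf
      (Lp.aestronglyMeasurable y)).measurable
    classical
    have h2 : Measurable fun w : Lp ℝ 2 μ => if MemLp (fun x => f (w x)) r μ then
        eLpNorm (fun x => f (w x) - y x) r μ else edist (0 : Lp ℝ r μ) y :=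
      Measurable.ite hset h1 measurable_const
    convert! h2 using 2 with w
    by_cases hw : MemLp (fun x => f (w x)) r μ
    · have e := coeFn_nemytskii hw
      rw [if_pos hw, Lp.edist_def]
      refine eLpNorm_congr_ae ?_
      filter_upwards [e] with x hx
      rw [Pi.sub_apply, hx]
    · simp [hw, nemytskii]
  obtain ⟨u', hu', he⟩ := hu
  exact ⟨fun t => nemytskii f r (u' t), (hmeas.comp hu'.measurable).stronglyMeasurable,
    he.mono fun t ht => by simp only [ht]⟩

/-- Finiteness of `∫∫ |f(u(t)(x))|^r dx dt` puts `t ↦ f(u(t))` into the Bochner space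
`L^r(·; L^r)`. -/
theorem memLp_nemytskii {s : ℝ} (hs : 1 ≤ s) [Fact (1 ≤ ENNReal.ofReal s)]
    [SecondCountableTopology (Lp ℝ (ENNReal.ofReal s) μ)] (hf : Continuous f) {α : Type*}
    [MeasurableSpace α] {ν : Measure α} {u : α → Lp ℝ 2 μ} (hu : AEStronglyMeasurable u ν)
    (hfin : ∫⁻ t, ∫⁻ x, ‖f (u t x)‖ₑ ^ s ∂μ ∂ν < ⊤) :
    MemLp (fun t => (nemytskii f (ENNReal.ofReal s) (u t) : Lp ℝ (ENNReal.ofReal s) μ))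
        (ENNReal.ofReal s) ν ∧
      ∀ᵐ t ∂ν, MemLp (fun x => f (u t x)) (ENNReal.ofReal s) μ := by
  have hs0 : 0 < s := by linarith
  have h0 : ENNReal.ofReal s ≠ 0 := by simpa using hs0
  have hr : (ENNReal.ofReal s).toReal = s := ENNReal.toReal_ofReal hs0.le
  have hpow : ∀ v : Lp ℝ 2 μ, eLpNorm (fun x => f (v x)) (ENNReal.ofReal s) μ ^ s =
      ∫⁻ x, ‖f (v x)‖ₑ ^ s ∂μ := by
    intro v
    rw [eLpNorm_eq_lintegral_rpow_enorm_toReal h0 ENNReal.ofReal_ne_top, hr, one_div,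
      ENNReal.rpow_inv_rpow hs0.ne']
  have hmeas : AEMeasurable (fun t => ∫⁻ x, ‖f (u t x)‖ₑ ^ s ∂μ) ν := by
    borelize ↥(Lp ℝ 2 μ)
    have h1 : Measurable fun w : Lp ℝ 2 μ => eLpNorm (fun x => f (w x)) (ENNReal.ofReal s) μ := by
      simpa using (lowerSemicontinuous_eLpNorm_comp_sub (r := ENNReal.ofReal s) (μ := μ) hf
        (y := fun _ => 0) aestronglyMeasurable_const).measurable
    simp_rw [← hpow]
    exact (h1.pow_const s).comp_aemeasurable hu.aemeasurable
  refine ⟨⟨aestronglyMeasurable_nemytskii hf hu, ?_⟩, ?_⟩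
  · rw [eLpNorm_lt_top_iff_lintegral_rpow_enorm_lt_top h0 ENNReal.ofReal_ne_top, hr]
    refine lt_of_le_of_lt (lintegral_mono fun t => ?_) hfin
    rw [← hpow]
    exact ENNReal.rpow_le_rpow (enorm_nemytskii_le (u t)) hs0.le
  · filter_upwards [ae_lt_top' hmeas hfin.ne] with t ht
    refine ⟨hf.comp_aestronglyMeasurable (Lp.aestronglyMeasurable _), ?_⟩
    rw [eLpNorm_lt_top_iff_lintegral_rpow_enorm_lt_top h0 ENNReal.ofReal_ne_top, hr]
    exact ht

end

/-! ### Distributional derivatives on a half-line -/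

theorem IsTestFunction.exists_tsupport_subset_Ioo {τ : ℝ} {φ : ℝ → ℝ}
    (hφ : IsTestFunction (Ioi τ) φ) : ∃ a b, τ < a ∧ a < b ∧ tsupport φ ⊆ Ioo a b := by
  obtain ⟨b, hb⟩ := hφ.hasCompactSupport.isCompact.bddAbove
  rcases (tsupport φ).eq_empty_or_nonempty with h | h
  · exact ⟨τ + 1, τ + 2, by linarith, by linarith, by rw [h]; exact empty_subset _⟩
  obtain ⟨a, ha, hle⟩ := hφ.hasCompactSupport.isCompact.exists_isLeast h
  have hτa : τ < a := hφ.tsupport_subset ha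
  refine ⟨(τ + a) / 2, max b a + 1, by linarith, by linarith [le_max_right b a], fun x hx => ?_⟩
  exact ⟨by linarith [hle hx], by linarith [hb hx, le_max_left b a]⟩

theorem IsTestFunction.integrableOn_mul {τ : ℝ} {ψ F : ℝ → ℝ} (hψ : IsTestFunction (Ioi τ) ψ)
    (hF : LocallyIntegrableOn F (Ioi τ)) : IntegrableOn (fun t => ψ t * F t) (Ioi τ) := by
  have h1 := (hF.integrableOn_compact_subset hψ.tsupport_subset
    hψ.hasCompactSupport.isCompact).continuousOn_mul hψ.contDiff.continuous.continuousOn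
    hψ.hasCompactSupport.isCompact
  refine (integrableOn_iff_integrable_of_support_subset ?_).1 h1 |>.integrableOn
  intro t ht
  refine subset_tsupport ψ ?_
  intro h0
  exact ht (by simp [h0])

/-- Integration by parts against a primitive. -/
theorem integral_deriv_mul_primitive {g φ : ℝ → ℝ} {a b : ℝ}
    (hg : IntervalIntegrable g volume a b) (hφ : ContDiff ℝ 1 φ) :
    ∫ t in a..b, deriv φ t * (∫ s in a..t, g s) =
      φ b * (∫ s in a..b, g s) - ∫ t in a..b, φ t * g t := by
  have h1 := AbsolutelyContinuousOnInterval.integral_mul_deriv_eq_deriv_mul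
    (hφ.contDiffOn (s := uIcc a b)).absolutelyContinuousOnInterval
    (hg.absolutelyContinuousOnInterval_intervalIntegral (c := a) left_mem_uIcc)
  have h2 : ∫ t in a..b, φ t * deriv (fun t => ∫ s in a..t, g s) t = ∫ t in a..b, φ t * g t := by
    refine intervalIntegral.integral_congr_ae ?_
    filter_upwards [hg.ae_hasDerivAt_integral] with t ht ht'
    rw [(ht (uIoc_subset_uIcc ht') a left_mem_uIcc).deriv]
  rw [h2, intervalIntegral.integral_same, mul_zero, sub_zero] at h1
  linarith

/-- The lemma of du Bois-Reymond: a function on `(τ, ∞)` with zero distributional derivative is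
constant. -/
theorem exists_ae_eq_const_of_integral_deriv_mul_eq_zero {τ : ℝ} {F : ℝ → ℝ}
    (hF : LocallyIntegrableOn F (Ioi τ))
    (h : ∀ φ, IsTestFunction (Ioi τ) φ → ∫ t in Ioi τ, deriv φ t * F t = 0) :
    ∃ c, ∀ᵐ t, τ < t → F t = c := by
  let ψ₀ : ContDiffBump (τ + 2) := ⟨1 / 2, 1, by norm_num, by norm_num⟩
  let ρ : ℝ → ℝ := ψ₀.normed volume
  have hρ : IsTestFunction (Ioi τ) ρ := by
    refine ⟨ψ₀.contDiff_normed, ψ₀.hasCompactSupport_normed, ?_⟩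
    rw [ψ₀.tsupport_normed_eq]
    intro x hx
    have hx' : |x - (τ + 2)| ≤ 1 := by simpa [Real.dist_eq] using hx
    have := (abs_le.1 hx').1
    change τ < x
    linarith
  have hρ1 : ∫ t, ρ t = 1 := ψ₀.integral_normed
  have hint : ∀ {ψ}, IsTestFunction (Ioi τ) ψ → Integrable ψ := fun hψ =>
    hψ.contDiff.continuous.integrable_of_hasCompactSupport hψ.hasCompactSupport
  -- a test function with vanishing integral is the derivative of a test function
  have hprim : ∀ χ, IsTestFunction (Ioi τ) χ → ∫ t, χ t = 0 →
      ∫ t in Ioi τ, χ t * F t = 0 := by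
    intro χ hχ hχ0
    obtain ⟨a, b, hτa, hab, hsupp⟩ := hχ.exists_tsupport_subset_Ioo
    have hχz : ∀ t, t ∉ Ioo a b → χ t = 0 := fun t ht =>
      image_eq_zero_of_notMem_tsupport fun h => ht (hsupp h)
    have hd : ∀ t, HasDerivAt (fun t => ∫ s in a..t, χ s) (χ t) t := fun t =>
      (hχ.contDiff.continuous).integral_hasStrictDerivAt a t |>.hasDerivAt
    have hderiv : deriv (fun t => ∫ s in a..t, χ s) = χ := funext fun t => (hd t).deriv
    have hz : ∀ t, t ∉ Icc a b → ∫ s in a..t, χ s = 0 := by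
      intro t ht
      rw [mem_Icc, not_and_or, not_le, not_le] at ht
      rcases ht with ht | ht
      · rw [intervalIntegral.integral_zero_ae]
        refine ae_of_all _ fun s hs => hχz s fun hs' => ?_
        rw [uIoc_of_ge ht.le] at hs
        linarith [hs.2, hs'.1]
      · rw [intervalIntegral.integral_of_le (hab.le.trans ht.le), ← hχ0]
        refine setIntegral_eq_integral_of_forall_compl_eq_zero fun s hs => hχz s fun hs' => ?_
        exact hs ⟨hs'.1, hs'.2.le.trans ht.le⟩
    have htest : IsTestFunction (Ioi τ) (fun t => ∫ s in a..t, χ s) := by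
      have hts : tsupport (fun t => ∫ s in a..t, χ s) ⊆ Icc a b :=
        closure_minimal (fun t ht => by
          by_contra hne
          exact ht (hz t hne)) isClosed_Icc
      refine ⟨?_, HasCompactSupport.intro isCompact_Icc hz,
        hts.trans fun t ht => hτa.trans_le ht.1⟩
      rw [contDiff_infty_iff_deriv, hderiv]
      exact ⟨fun t => (hd t).differentiableAt, hχ.contDiff⟩
    have := h _ htest
    rwa [hderiv] at this
  have hmul : ∀ {ψ}, IsTestFunction (Ioi τ) ψ → IntegrableOn (fun t => ψ t * F t) (Ioi τ) :=
    fun hψ => hψ.integrableOn_mul hF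
  set c := ∫ t in Ioi τ, ρ t * F t with hc
  refine ⟨c, ?_⟩
  have hFc : LocallyIntegrableOn (fun t => F t - c) (Ioi τ) :=
    hF.sub ((locallyIntegrable_const c).locallyIntegrableOn _)
  have := isOpen_Ioi.ae_eq_zero_of_integral_contDiff_smul_eq_zero hFc fun ψ hψ1 hψ2 hψ3 => by
    have hψ : IsTestFunction (Ioi τ) ψ := ⟨hψ1, hψ2, hψ3⟩
    set I := ∫ t, ψ t with hI
    have hχ : IsTestFunction (Ioi τ) (fun t => ψ t - I * ρ t) := by
      refine ⟨hψ1.sub (contDiff_const.mul hρ.contDiff),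
        hψ2.sub (hρ.hasCompactSupport.mul_left), ?_⟩
      refine (tsupport_sub _ _).trans (union_subset hψ3 ?_)
      exact (closure_mono (Function.support_mul_subset_right _ _)).trans hρ.tsupport_subset
    have h0 : ∫ t, (ψ t - I * ρ t) = 0 := by
      rw [integral_sub (hint hψ) ((hint hρ).const_mul I), integral_const_mul, hρ1]
      simp [hI]
    have h1 := hprim _ hχ h0
    have h2 : ∫ t in Ioi τ, (ψ t - I * ρ t) * F t = (∫ t in Ioi τ, ψ t * F t) - I * c := by
      rw [hc, ← integral_const_mul, ← integral_sub (hmul hψ) ((hmul hρ).const_mul I)]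
      congr 1
      funext t
      ring
    have hIoi : ∫ t in Ioi τ, ψ t = I :=
      setIntegral_eq_integral_of_forall_compl_eq_zero fun t ht =>
        image_eq_zero_of_notMem_tsupport fun h => ht (hψ3 h)
    have h3 : ∫ t, ψ t • (F t - c) = ∫ t in Ioi τ, ψ t • (F t - c) :=
      (setIntegral_eq_integral_of_forall_compl_eq_zero fun t ht => by
        rw [image_eq_zero_of_notMem_tsupport fun h => ht (hψ3 h), zero_smul]).symm
    rw [h3]
    simp only [smul_eq_mul, mul_sub]
    rw [integral_sub (hmul hψ) ((hint hψ).integrableOn.mul_const c), integral_mul_const, hIoi]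
    linarith
  filter_upwards [this] with t ht hτt
  exact sub_eq_zero.1 (ht hτt)

theorem locallyIntegrableOn_Ioi_of_Ioo {τ : ℝ} {g : ℝ → ℝ}
    (hg : ∀ T, τ < T → IntegrableOn g (Ioo τ T)) : LocallyIntegrableOn g (Ioi τ) := by
  intro x hx
  have hx' : τ < x := hx
  exact ⟨Ioo τ (x + 1), mem_nhdsWithin_of_mem_nhds (Ioo_mem_nhds hx' (by linarith)),
    hg (x + 1) (by linarith)⟩

theorem continuousOn_primitive_Ici {τ : ℝ} {g : ℝ → ℝ}
    (hg : ∀ T, τ < T → IntegrableOn g (Ioo τ T)) :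
    ContinuousOn (fun t => ∫ s in τ..t, g s) (Ici τ) := by
  intro t ht
  have ht' : τ ≤ t := ht
  have h1 : IntegrableOn g (uIcc τ (t + 1)) := by
    rw [uIcc_of_le (by linarith), integrableOn_Icc_iff_integrableOn_Ioo]
    exact hg _ (by linarith)
  have h2 := intervalIntegral.continuousOn_primitive_interval h1
  rw [uIcc_of_le (by linarith)] at h2
  refine (h2 t ⟨ht', by linarith⟩).mono_of_mem_nhdsWithin ?_
  exact mem_nhdsWithin.2 ⟨Iio (t + 1), isOpen_Iio, by simp, fun x hx => ⟨hx.2, le_of_lt hx.1⟩⟩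

/-- A function whose distributional derivative `g` is integrable near `τ`, and which has the limit
`y₀` at `τ`, is the primitive of `g` with value `y₀` at `τ`. -/
theorem ae_eq_add_integral_of_weak_deriv {τ y₀ : ℝ} {y g : ℝ → ℝ}
    (hy : ∀ T, τ < T → IntegrableOn y (Ioo τ T)) (hg : ∀ T, τ < T → IntegrableOn g (Ioo τ T))
    (heq : ∀ φ, IsTestFunction (Ioi τ) φ →
      -(∫ t in Ioi τ, deriv φ t * y t) = ∫ t in Ioi τ, φ t * g t)
    (hlim : Tendsto y (𝓝[>] τ ⊓ ae volume) (𝓝 y₀)) :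
    ∀ᵐ t, τ < t → y t = y₀ + ∫ s in τ..t, g s := by
  have hprim := continuousOn_primitive_Ici hg
  have hyl := locallyIntegrableOn_Ioi_of_Ioo hy
  have hpl : LocallyIntegrableOn (fun t => ∫ s in τ..t, g s) (Ioi τ) :=
    (hprim.mono Ioi_subset_Ici_self).locallyIntegrableOn measurableSet_Ioi
  obtain ⟨c, hc⟩ := exists_ae_eq_const_of_integral_deriv_mul_eq_zero (hyl.sub hpl) fun φ hφ => by
    obtain ⟨a, b, hτa, hab, hsupp⟩ := hφ.exists_tsupport_subset_Ioo
    have hτb : τ < b := hτa.trans hab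
    have hφz : ∀ t, t ∉ Ioo a b → φ t = 0 := fun t ht =>
      image_eq_zero_of_notMem_tsupport fun h => ht (hsupp h)
    have hφz' : ∀ t, t ∉ Ioo a b → deriv φ t = 0 := fun t ht => by
      by_contra hne
      exact ht (hsupp (support_deriv_subset hne))
    have hφc := hφ.contDiff.continuous
    have hφc' : Continuous (deriv φ) := hφ.contDiff.continuous_deriv (by simp)
    have hIoi : ∀ {k : ℝ → ℝ}, (∀ t, t ∉ Ioo a b → k t = 0) →
        ∫ t in Ioi τ, k t = ∫ t in τ..b, k t := by
      intro k hk
      rw [intervalIntegral.integral_of_le hτb.le,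
        setIntegral_eq_integral_of_forall_compl_eq_zero (s := Ioi τ) fun t ht => hk t fun h =>
          ht (hτa.trans h.1),
        setIntegral_eq_integral_of_forall_compl_eq_zero (s := Ioc τ b) fun t ht => hk t fun h =>
          ht ⟨hτa.trans h.1, h.2.le⟩]
    have hyi : IntervalIntegrable y volume τ b := by
      rw [intervalIntegrable_iff_integrableOn_Ioc_of_le hτb.le,
        integrableOn_Ioc_iff_integrableOn_Ioo]
      exact hy b hτb
    have hgi : IntervalIntegrable g volume τ b := by
      rw [intervalIntegrable_iff_integrableOn_Ioc_of_le hτb.le,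
        integrableOn_Ioc_iff_integrableOn_Ioo]
      exact hg b hτb
    have hpi : IntervalIntegrable (fun t => ∫ s in τ..t, g s) volume τ b :=
      (hprim.mono (by rw [uIcc_of_le hτb.le]; exact Icc_subset_Ici_self)).intervalIntegrable
    have h1 := heq φ hφ
    rw [hIoi fun t ht => by rw [hφz' t ht, zero_mul],
      hIoi fun t ht => by rw [hφz t ht, zero_mul]] at h1
    have h2 := integral_deriv_mul_primitive hgi (hφ.contDiff.of_le (by simp))
    rw [hφz b (by simp), zero_mul, zero_sub] at h2
    rw [hIoi fun t ht => by rw [hφz' t ht, zero_mul]]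
    simp only [Pi.sub_apply, mul_sub]
    rw [intervalIntegral.integral_sub (hyi.continuousOn_mul hφc'.continuousOn)
      (hpi.continuousOn_mul hφc'.continuousOn)]
    linarith
  have := neBot_nhdsGT_inf_ae τ
  have hpτ : Tendsto (fun t => ∫ s in τ..t, g s) (𝓝[>] τ ⊓ ae volume) (𝓝 0) := by
    have h1 := (hprim τ self_mem_Ici).tendsto
    rw [intervalIntegral.integral_same] at h1
    exact h1.mono_left (inf_le_left.trans (nhdsWithin_mono _ Ioi_subset_Ici_self))
  have hcy : c = y₀ := by
    have h1 := hlim.sub hpτ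
    rw [sub_zero] at h1
    refine tendsto_nhds_unique (tendsto_const_nhds.congr' ?_) h1
    have hlt : ∀ᶠ t in 𝓝[>] τ ⊓ ae volume, τ < t :=
      (eventually_mem_nhdsWithin (s := Ioi τ)).filter_mono inf_le_left
    filter_upwards [hlt, hc.filter_mono inf_le_right] with t h1 h2
    exact (h2 h1).symm
  filter_upwards [hc] with t ht hτt
  have := ht hτt
  simp only [Pi.sub_apply] at this
  rw [← hcy]
  linarith

/-! ### Functionals on `H¹₀(Ω)` and on `L^p(Ω)` -/

instance fact_two_ne_top : Fact ((2 : ℝ≥0∞) ≠ ⊤) := ⟨by norm_num⟩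

section
variable {N : ℕ} {Ω : Set (EuclideanSpace ℝ (Fin N))}

instance secondCountableTopology_H10 : SecondCountableTopology (H10 Ω) := by
  have h1 : SecondCountableTopology (L2 Ω) := Lp.SecondCountableTopology
  have h2 : SecondCountableTopology (L2Vec Ω) := Lp.SecondCountableTopology
  have h3 : SecondCountableTopology (WithLp 2 (L2 Ω × L2Vec Ω)) :=
    (WithLp.prodContinuousLinearEquiv 2 ℝ (L2 Ω) (L2Vec Ω)).toHomeomorph.isInducing
      |>.secondCountableTopology
  exact TopologicalSpace.Subtype.secondCountableTopology _

/-- The functional `w ↦ (x, ∇w)` on `H¹₀(Ω)`, for a vector field `x`; it is `-div x ∈ H⁻¹(Ω)`. -/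
noncomputable def innerGrad (x : L2Vec Ω) : HMinusOne Ω := (innerSL ℝ x).comp (weakGradL Ω)

theorem innerGrad_apply (x : L2Vec Ω) (v : H10 Ω) : innerGrad x v = ⟪x, weakGrad v⟫_ℝ := rfl

theorem norm_innerGrad_le (x : L2Vec Ω) : ‖innerGrad x‖ ≤ ‖x‖ := by
  refine ContinuousLinearMap.opNorm_le_bound _ (norm_nonneg _) fun v => ?_
  rw [innerGrad_apply]
  refine (norm_inner_le_norm _ _).trans ?_
  gcongr
  exact norm_weakGrad_le v

theorem continuous_innerGrad : Continuous (innerGrad : L2Vec Ω → HMinusOne Ω) := by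
  unfold innerGrad
  fun_prop

/-- The functional on `L^p(Ω)` given by the integral against an element of `L^q(Ω)`. -/
noncomputable def integralPairing (Ω : Set (EuclideanSpace ℝ (Fin N))) (p q : ℝ≥0∞)
    [Fact (1 ≤ p)] [Fact (1 ≤ q)] [q.HolderConjugate p] :
    Lp ℝ q (volume.restrict Ω) →L[ℝ] StrongDual ℝ (Lp ℝ p (volume.restrict Ω)) :=
  ContinuousLinearMap.lpPairing (volume.restrict Ω) q p (ContinuousLinearMap.mul ℝ ℝ)

theorem integralPairing_apply {p q : ℝ≥0∞} [Fact (1 ≤ p)] [Fact (1 ≤ q)] [q.HolderConjugate p]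
    {g : Lp ℝ q (volume.restrict Ω)} {v : Lp ℝ p (volume.restrict Ω)}
    {g' v' : EuclideanSpace ℝ (Fin N) → ℝ} (hg : g =ᵐ[volume.restrict Ω] g')
    (hv : v =ᵐ[volume.restrict Ω] v') :
    integralPairing Ω p q g v = ∫ x in Ω, g' x * v' x := by
  rw [integralPairing, ContinuousLinearMap.lpPairing_eq_integral]
  refine integral_congr_ae ?_
  filter_upwards [hg, hv] with x h1 h2
  rw [h1, h2]
  rfl

/-- Test functions, hence `H¹₀(Ω) ∩ L^p(Ω)`, are dense in `L²(Ω)`. -/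
theorem dense_toL2 (hΩ : IsOpen Ω) (p : ℝ≥0∞) :
    Dense {x : L2 Ω | ∃ v : H10 Ω, MemLp (toL2 v) p (volume.restrict Ω) ∧ toL2 v = x} := by
  let K : Submodule ℝ (L2 Ω) :=
    { carrier := {x : L2 Ω | ∃ v : H10 Ω, MemLp (toL2 v) p (volume.restrict Ω) ∧ toL2 v = x}
      zero_mem' := ⟨0, (MemLp.zero (ε := ℝ)).ae_eq (Lp.coeFn_zero _ _ _).symm, rfl⟩
      add_mem' := by
        rintro _ _ ⟨v, hv, rfl⟩ ⟨w, hw, rfl⟩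
        exact ⟨v + w, (hv.add hw).ae_eq (Lp.coeFn_add _ _).symm, rfl⟩
      smul_mem' := by
        rintro c _ ⟨v, hv, rfl⟩
        exact ⟨c • v, (hv.const_smul c).ae_eq (Lp.coeFn_smul _ _).symm, rfl⟩ }
  -- an element orthogonal to all test functions vanishes
  change Dense (K : Set (L2 Ω))
  rw [Submodule.dense_iff_topologicalClosure_eq_top, Submodule.topologicalClosure_eq_top_iff,
    Submodule.eq_bot_iff]
  intro y hy
  rw [Submodule.mem_orthogonal] at hy
  have hloc : LocallyIntegrableOn y Ω volume :=
    locallyIntegrableOn_of_locallyIntegrable_restrict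
      ((Lp.memLp y).locallyIntegrable (by norm_num))
  have h0 := hΩ.ae_eq_zero_of_integral_contDiff_smul_eq_zero hloc fun φ h1 h2 h3 => by
    have hg : Continuous (gradient φ) :=
      (InnerProductSpace.toDual ℝ (EuclideanSpace ℝ (Fin N))).symm.continuous.comp
        (h1.continuous_fderiv (by simp))
    have hgc : HasCompactSupport (gradient φ) := h2.fderiv ℝ |>.comp_left (map_zero _)
    have m1 : MemLp φ 2 (volume.restrict Ω) :=
      (h1.continuous.memLp_of_hasCompactSupport h2).restrict Ω
    have m2 : MemLp (gradient φ) 2 (volume.restrict Ω) :=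
      (hg.memLp_of_hasCompactSupport hgc).restrict Ω
    let z : WithLp 2 (L2 Ω × L2Vec Ω) := WithLp.toLp 2 (m1.toLp φ, m2.toLp _)
    have hz : z ∈ testPairs Ω := ⟨φ, ⟨h1, h2, h3⟩, m1.coeFn_toLp, m2.coeFn_toLp⟩
    have hv : MemLp (m1.toLp φ) p (volume.restrict Ω) :=
      ((h1.continuous.memLp_of_hasCompactSupport h2).restrict Ω).ae_eq m1.coeFn_toLp.symm
    have := hy (m1.toLp φ) ⟨⟨z, Submodule.le_topologicalClosure _ hz⟩, hv, rfl⟩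
    rw [L2.inner_def] at this
    rw [← setIntegral_eq_integral_of_forall_compl_eq_zero (s := Ω) fun x hx => by
      rw [image_eq_zero_of_notMem_tsupport fun h => hx (h3 h), zero_smul], ← this]
    refine integral_congr_ae ?_
    filter_upwards [m1.coeFn_toLp] with x hx
    rw [hx]
    simp [mul_comm]
  refine (Lp.eq_zero_iff_ae_eq_zero).2 ?_
  exact (ae_restrict_iff' hΩ.measurableSet).2 h0

/-- The growth condition with exponent `p - 1` maps `L^p` into `L^q`, since `(p - 1) q = p`. -/
theorem rpow_enorm_le_of_growth {κ₁ α₁ p q : ℝ} {f : ℝ → ℝ} (hκ : 0 ≤ κ₁) (hα : 0 ≤ α₁)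
    (hqp : q.HolderConjugate p) (hf : ∀ s, |f s| ≤ κ₁ + α₁ * |s| ^ (p - 1)) (s : ℝ) :
    ‖f s‖ₑ ^ q ≤ ENNReal.ofReal ((κ₁ + α₁) ^ q) * (1 + ‖s‖ₑ ^ p) := by
  have hq := hqp.pos
  have hp := hqp.symm.pos
  have hp1 : 0 < p - 1 := hqp.symm.sub_one_pos
  have hmax : (1 : ℝ) ≤ max 1 |s| := le_max_left _ _
  have h1 : |f s| ≤ (κ₁ + α₁) * max 1 |s| ^ (p - 1) := by
    refine (hf s).trans ?_
    rw [add_mul]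
    gcongr
    · exact le_mul_of_one_le_right hκ (Real.one_le_rpow hmax hp1.le)
    · exact le_max_right _ _
  have h2 : |f s| ^ q ≤ (κ₁ + α₁) ^ q * (1 + |s| ^ p) := by
    calc |f s| ^ q ≤ ((κ₁ + α₁) * max 1 |s| ^ (p - 1)) ^ q := by gcongr
      _ = (κ₁ + α₁) ^ q * max 1 |s| ^ p := by
        rw [Real.mul_rpow (by positivity) (by positivity), ← Real.rpow_mul (by positivity),
          hqp.symm.sub_one_mul_conj]
      _ ≤ _ := by
        gcongr
        rcases le_total 1 |s| with h | h
        · rw [max_eq_right h]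
          linarith
        · rw [max_eq_left h, Real.one_rpow]
          linarith [Real.rpow_nonneg (abs_nonneg s) p]
  rw [Real.enorm_eq_ofReal_abs, Real.enorm_eq_ofReal_abs, ENNReal.ofReal_rpow_of_nonneg
    (abs_nonneg _) hq.le, ENNReal.ofReal_rpow_of_nonneg (abs_nonneg _) hp.le,
    ← ENNReal.ofReal_one, ← ENNReal.ofReal_add zero_le_one (by positivity),
    ← ENNReal.ofReal_mul (by positivity)]
  exact ENNReal.ofReal_le_ofReal h2

theorem ae_of_forall_ae_Ioo {τ : ℝ} {P : ℝ → Prop}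
    (h : ∀ T, τ < T → ∀ᵐ t ∂(volume.restrict (Ioo τ T)), P t) : ∀ᵐ t, τ < t → P t := by
  have h1 : ∀ n : ℕ, ∀ᵐ t, t ∈ Ioo τ (τ + (n + 1)) → P t := fun n =>
    (ae_restrict_iff' measurableSet_Ioo).1 (h _ (by linarith [n.cast_nonneg (α := ℝ)]))
  filter_upwards [ae_all_iff.2 h1] with t ht hτt
  obtain ⟨n, hn⟩ := exists_nat_gt (t - τ)
  exact ht n ⟨hτt, by linarith⟩

end

/-! ### Weak solutions as weak evolutions -/

section
variable {N : ℕ} {Ω : Set (EuclideanSpace ℝ (Fin N))}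

/-- The norm structure of the dual space, stated for `HMinusOne Ω` because instance search does not
find the classes needed for integrability through the abbreviation. -/
noncomputable instance normedAddCommGroup_HMinusOne : NormedAddCommGroup (HMinusOne Ω) :=
  ContinuousLinearMap.toNormedAddCommGroup
noncomputable instance normedSpace_HMinusOne : NormedSpace ℝ (HMinusOne Ω) :=
  ContinuousLinearMap.toNormedSpace

/-- The part of `∂u/∂t` with values in `H⁻¹(Ω)`, namely `a((l, u)) Δu + h`. -/
noncomputable def diffusionTerm (a : ℝ → ℝ) (l : L2 Ω) (h : ℝ → HMinusOne Ω) (u : ℝ → H10 Ω)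
    (t : ℝ) : HMinusOne Ω :=
  -(a ⟪l, toL2 (u t)⟫_ℝ • innerGrad (weakGrad (u t))) + h t

/-- The part of `∂u/∂t` with values in `L^q(Ω)`, namely `f(u)`, as a functional on `L^p(Ω)`. -/
noncomputable def reactionTerm (f : ℝ → ℝ) (p q : ℝ≥0∞) [Fact (1 ≤ p)] [Fact (1 ≤ q)]
    [q.HolderConjugate p] (u : ℝ → H10 Ω) (t : ℝ) :
    StrongDual ℝ (Lp ℝ p (volume.restrict Ω)) :=
  integralPairing Ω p q (nemytskii f q (toL2 (u t)))

namespace IsWeakSolution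

variable {p q : ℝ} {a f : ℝ → ℝ} {l : L2 Ω} {h : ℝ → HMinusOne Ω} {τ : ℝ} {uτ : L2 Ω}
  {u : ℝ → H10 Ω}

/-- `a((l, u)) Δu + h ∈ L²(τ,T; H⁻¹(Ω))`. The coefficient is bounded because
`u ∈ L^∞(τ,T; L²(Ω))`. -/
theorem memLp_diffusionTerm (hu : IsWeakSolution p a f l h τ uτ u) (ha : Continuous a)
    (hh : ∀ b c, MemLp (h) 2 (volume.restrict (Ioo b c))) {T : ℝ} (hT : τ < T) :
    MemLp (diffusionTerm a l h u) 2 (volume.restrict (Ioo τ T)) := by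
  have hum := (hu.memLp_two T hT).1
  have hum1 : AEStronglyMeasurable (fun t => toL2 (u t)) (volume.restrict (Ioo τ T)) :=
    (hu.memLp_top T hT).1
  have hum2 : AEStronglyMeasurable (fun t => weakGrad (u t)) (volume.restrict (Ioo τ T)) :=
    (weakGradL Ω).continuous.comp_aestronglyMeasurable hum
  set M := (eLpNorm (fun t => toL2 (u t)) ⊤ (volume.restrict (Ioo τ T))).toReal with hM
  have hb : ∀ᵐ t ∂(volume.restrict (Ioo τ T)), ‖toL2 (u t)‖ ≤ M := by
    filter_upwards [ae_le_eLpNormEssSup (f := fun t => toL2 (u t))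
      (μ := volume.restrict (Ioo τ T))] with t ht
    rw [← toReal_enorm, hM]
    refine ENNReal.toReal_mono (hu.memLp_top T hT).2.ne ?_
    rwa [eLpNorm_exponent_top]
  -- `(l, u(t))` stays in a compact interval, on which `a` is bounded
  obtain ⟨C, hC⟩ := (isCompact_closedBall (0 : ℝ) (‖l‖ * M)).exists_bound_of_continuousOn
    ha.continuousOn
  refine MemLp.add (MemLp.neg ?_) (hh τ T)
  refine MemLp.of_le_mul (c := C) (hu.memLp_two T hT) ?_ ?_
  · refine AEStronglyMeasurable.smul (ha.comp_aestronglyMeasurable ?_)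
      (continuous_innerGrad.comp_aestronglyMeasurable hum2)
    exact (aestronglyMeasurable_const (b := l)).inner hum1
  · filter_upwards [hb] with t ht
    have hle : ‖a ⟪l, toL2 (u t)⟫_ℝ‖ ≤ C := hC _ (by
      rw [mem_closedBall_zero_iff]
      exact (norm_inner_le_norm _ _).trans (by gcongr))
    rw [norm_smul]
    have := (norm_nonneg _).trans hle
    gcongr
    exact (norm_innerGrad_le _).trans (norm_weakGrad_le _)

/-- `u ∈ L^p(τ,T; L^p(Ω))` as a Bochner space. -/
theorem memLp_nemytskii_id [Fact (1 ≤ ENNReal.ofReal p)] (hp : 1 ≤ p)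
    (hu : IsWeakSolution p a f l h τ uτ u) {T : ℝ} (hT : τ < T) :
    MemLp (fun t => nemytskii (fun s => s) (ENNReal.ofReal p) (toL2 (u t))) (ENNReal.ofReal p)
      (volume.restrict (Ioo τ T)) ∧ ∀ᵐ t ∂(volume.restrict (Ioo τ T)),
        MemLp (toL2 (u t)) (ENNReal.ofReal p) (volume.restrict Ω) := by
  have : Fact (ENNReal.ofReal p ≠ ⊤) := ⟨ENNReal.ofReal_ne_top⟩
  have : SecondCountableTopology (Lp ℝ (ENNReal.ofReal p) (volume.restrict Ω)) :=
    Lp.SecondCountableTopology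
  exact memLp_nemytskii hp continuous_id (hu.memLp_top T hT).1 (hu.lintegral_p T hT)

/-- `f(u) ∈ L^q(τ,T; L^q(Ω))`. -/
theorem memLp_nemytskii_reaction [IsFiniteMeasure (volume.restrict Ω)]
    [Fact (1 ≤ ENNReal.ofReal q)] {κ₁ α₁ : ℝ} (hκ : 0 ≤ κ₁) (hα : 0 ≤ α₁)
    (hqp : q.HolderConjugate p) (hf : Continuous f)
    (hgrow : ∀ s, |f s| ≤ κ₁ + α₁ * |s| ^ (p - 1))
    (hu : IsWeakSolution p a f l h τ uτ u) {T : ℝ} (hT : τ < T) :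
    MemLp (fun t => nemytskii f (ENNReal.ofReal q) (toL2 (u t))) (ENNReal.ofReal q)
      (volume.restrict (Ioo τ T)) ∧ ∀ᵐ t ∂(volume.restrict (Ioo τ T)),
        MemLp (fun x => f (toL2 (u t) x)) (ENNReal.ofReal q) (volume.restrict Ω) := by
  have : Fact (ENNReal.ofReal q ≠ ⊤) := ⟨ENNReal.ofReal_ne_top⟩
  have : SecondCountableTopology (Lp ℝ (ENNReal.ofReal q) (volume.restrict Ω)) :=
    Lp.SecondCountableTopology
  refine memLp_nemytskii hqp.lt.le hf (hu.memLp_top T hT).1 ?_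
  calc ∫⁻ t in Ioo τ T, ∫⁻ x in Ω, ‖f (toL2 (u t) x)‖ₑ ^ q
      ≤ ∫⁻ t in Ioo τ T, ENNReal.ofReal ((κ₁ + α₁) ^ q) *
          (volume Ω + ∫⁻ x in Ω, ‖toL2 (u t) x‖ₑ ^ p) := by
        refine lintegral_mono fun t => ?_
        refine (lintegral_mono fun x => rpow_enorm_le_of_growth hκ hα hqp hgrow _).trans ?_
        rw [lintegral_const_mul' _ _ ENNReal.ofReal_ne_top, lintegral_add_left measurable_const]
        simp
    _ = ENNReal.ofReal ((κ₁ + α₁) ^ q) * ((∫⁻ _ in Ioo τ T, volume Ω) +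
          ∫⁻ t in Ioo τ T, ∫⁻ x in Ω, ‖toL2 (u t) x‖ₑ ^ p) := by
        rw [lintegral_const_mul' _ _ ENNReal.ofReal_ne_top, lintegral_add_left measurable_const]
    _ < ⊤ := by
        refine ENNReal.mul_lt_top ENNReal.ofReal_lt_top
          (ENNReal.add_lt_top.2 ⟨?_, hu.lintegral_p T hT⟩)
        have : volume Ω < ⊤ := by
          have := measure_lt_top (volume.restrict Ω) univ
          rwa [Measure.restrict_apply_univ] at this
        rw [lintegral_const]
        exact ENNReal.mul_lt_top this (by simp)

variable [IsFiniteMeasure (volume.restrict Ω)] [Fact (1 ≤ ENNReal.ofReal p)]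
  [Fact (1 ≤ ENNReal.ofReal q)] [(ENNReal.ofReal q).HolderConjugate (ENNReal.ofReal p)]

theorem memLp_reactionTerm {κ₁ α₁ : ℝ} (hκ : 0 ≤ κ₁) (hα : 0 ≤ α₁)
    (hqp : q.HolderConjugate p) (hf : Continuous f)
    (hgrow : ∀ s, |f s| ≤ κ₁ + α₁ * |s| ^ (p - 1))
    (hu : IsWeakSolution p a f l h τ uτ u) {T : ℝ} (hT : τ < T) :
    MemLp (reactionTerm f (ENNReal.ofReal p) (ENNReal.ofReal q) u) (ENNReal.ofReal q)
      (volume.restrict (Ioo τ T)) :=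
  (integralPairing Ω (ENNReal.ofReal p) (ENNReal.ofReal q)).comp_memLp'
    (hu.memLp_nemytskii_reaction hκ hα hqp hf hgrow hT).1

/-- The weak formulation, integrated in time, for a fixed `v ∈ H¹₀(Ω) ∩ L^p(Ω)`. -/
theorem ae_inner_sub_eq {κ₁ α₁ : ℝ} (hκ : 0 ≤ κ₁) (hα : 0 ≤ α₁)
    (hqp : q.HolderConjugate p) (ha : Continuous a) (hf : Continuous f)
    (hgrow : ∀ s, |f s| ≤ κ₁ + α₁ * |s| ^ (p - 1))
    (hh : ∀ b c, MemLp h 2 (volume.restrict (Ioo b c)))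
    (hu : IsWeakSolution p a f l h τ uτ u) (v : H10 Ω)
    (y : Lp ℝ (ENNReal.ofReal p) (volume.restrict Ω)) (hvy : toL2 v =ᵐ[volume.restrict Ω] y) :
    (∀ T, τ < T → IntegrableOn (fun r => diffusionTerm a l h u r v +
      reactionTerm f (ENNReal.ofReal p) (ENNReal.ofReal q) u r y) (Ioo τ T)) ∧
    ∀ᵐ t, τ < t → ⟪toL2 (u t), toL2 v⟫_ℝ = ⟪uτ, toL2 v⟫_ℝ + ∫ r in τ..t,
      (diffusionTerm a l h u r v +
        reactionTerm f (ENNReal.ofReal p) (ENNReal.ofReal q) u r y) := by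
  have hv : MemLp (toL2 v) (ENNReal.ofReal p) (volume.restrict Ω) := (Lp.memLp y).ae_eq hvy.symm
  have i1 : ∀ T, τ < T → IntegrableOn (fun r => diffusionTerm a l h u r v) (Ioo τ T) :=
    fun T hT => ((hu.memLp_diffusionTerm ha hh hT).integrable
      (by norm_num)).apply_continuousLinearMap v
  have i2 : ∀ T, τ < T → IntegrableOn
      (fun r => reactionTerm f (ENNReal.ofReal p) (ENNReal.ofReal q) u r y) (Ioo τ T) :=
    fun T hT => ((hu.memLp_reactionTerm hκ hα hqp hf hgrow hT).integrable
      Fact.out).apply_continuousLinearMap y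
  have i3 : ∀ T, τ < T → IntegrableOn (fun r => h r v) (Ioo τ T) :=
    fun T hT => ((hh τ T).integrable (by norm_num)).apply_continuousLinearMap v
  have i4 : ∀ T, τ < T → IntegrableOn (fun t => ⟪toL2 (u t), toL2 v⟫_ℝ) (Ioo τ T) := by
    intro T hT
    exact ((hu.memLp_top T hT).integrable le_top).inner_const (toL2 v)
  have i12 : ∀ T, τ < T → IntegrableOn (fun r => diffusionTerm a l h u r v +
      reactionTerm f (ENNReal.ofReal p) (ENNReal.ofReal q) u r y) (Ioo τ T) :=
    fun T hT => (i1 T hT).add (i2 T hT)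
  refine ⟨i12, ae_eq_add_integral_of_weak_deriv i4 i12 (fun φ hφ => ?_) (hu.initial v hv)⟩
  have heq := hu.equation v hv φ hφ
  have hA : ∀ t, a ⟪l, toL2 (u t)⟫_ℝ * ⟪weakGrad (u t), weakGrad v⟫_ℝ =
      h t v - diffusionTerm a l h u t v := by
    intro t
    simp only [diffusionTerm, _root_.add_apply, _root_.neg_apply, _root_.smul_apply,
      innerGrad_apply, smul_eq_mul]
    ring
  have hae : ∀ᵐ t ∂(volume.restrict (Ioi τ)), ∫ x in Ω, f (toL2 (u t) x) * toL2 v x =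
      reactionTerm f (ENNReal.ofReal p) (ENNReal.ofReal q) u t y := by
    rw [ae_restrict_iff' measurableSet_Ioi]
    refine ae_of_forall_ae_Ioo fun T hT => ?_
    filter_upwards [(hu.memLp_nemytskii_reaction hκ hα hqp hf hgrow hT).2] with t ht
    exact (integralPairing_apply (coeFn_nemytskii ht) hvy.symm).symm
  have e1 : ∫ t in Ioi τ, φ t * ((∫ x in Ω, f (toL2 (u t) x) * toL2 v x) + h t v) =
      ∫ t in Ioi τ, (φ t * reactionTerm f (ENNReal.ofReal p) (ENNReal.ofReal q) u t y +
        φ t * h t v) := by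
    refine integral_congr_ae ?_
    filter_upwards [hae] with t ht
    rw [ht, mul_add]
  simp_rw [hA, mul_sub] at heq
  have k1 := hφ.integrableOn_mul (locallyIntegrableOn_Ioi_of_Ioo i1)
  have k2 := hφ.integrableOn_mul (locallyIntegrableOn_Ioi_of_Ioo i2)
  have k3 := hφ.integrableOn_mul (locallyIntegrableOn_Ioi_of_Ioo i3)
  rw [e1, integral_add k2 k3, integral_sub k3 k1] at heq
  simp_rw [mul_add]
  rw [integral_add k1 k2]
  linarith

/-- A weak solution, together with its time derivative in `L²(H⁻¹) + L^q(L^q)`, is a weak evolution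
in `L²(Ω)`. -/
theorem exists_isWeakEvolution (hΩ : IsOpen Ω) {κ₁ α₁ : ℝ} (hκ : 0 ≤ κ₁) (hα : 0 ≤ α₁)
    (hqp : q.HolderConjugate p) (ha : Continuous a) (hf : Continuous f)
    (hgrow : ∀ s, |f s| ≤ κ₁ + α₁ * |s| ^ (p - 1))
    (hh : ∀ b c, MemLp h 2 (volume.restrict (Ioo b c)))
    (hu : IsWeakSolution p a f l h τ uτ u) :
    ∃ G, IsWeakEvolution (ENNReal.ofReal p) (ENNReal.ofReal q) τ uτ G (fun t => toL2 (u t))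
      (diffusionTerm a l h u) u (reactionTerm f (ENNReal.ofReal p) (ENNReal.ofReal q) u)
      (fun t => nemytskii (fun s => s) (ENNReal.ofReal p) (toL2 (u t))) := by
  have : Fact (ENNReal.ofReal p ≠ ⊤) := ⟨ENNReal.ofReal_ne_top⟩
  have : SecondCountableTopology (Lp ℝ (ENNReal.ofReal p) (volume.restrict Ω)) :=
    Lp.SecondCountableTopology
  have hp1 : 1 ≤ p := hqp.symm.lt.le
  have mΓ₁ := fun T hT => hu.memLp_diffusionTerm ha hh (T := T) hT
  have mΓ₂ := fun T hT => hu.memLp_reactionTerm hκ hα hqp hf hgrow (T := T) hT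
  have mZ₂ := fun T hT => hu.memLp_nemytskii_id hp1 (T := T) hT
  have iΓ₁ : ∀ {t}, τ ≤ t → IntervalIntegrable (diffusionTerm a l h u) volume τ t :=
    fun ht => IsWeakEvolution.intervalIntegrable_of_memLp (q := 2) mΓ₁ ht
  have iΓ₂ : ∀ {t}, τ ≤ t → IntervalIntegrable
      (reactionTerm f (ENNReal.ofReal p) (ENNReal.ofReal q) u) volume τ t :=
    fun ht => IsWeakEvolution.intervalIntegrable_of_memLp mΓ₂ ht
  -- `H¹₀(Ω) ∩ L^p(Ω)` is separable, so one null set of times serves all its elements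
  let V : Set (H10 Ω × Lp ℝ (ENNReal.ofReal p) (volume.restrict Ω)) :=
    {x | toL2 x.1 =ᵐ[volume.restrict Ω] x.2}
  obtain ⟨D, hDV, hDc, hVD⟩ :=
    (TopologicalSpace.IsSeparable.of_separableSpace V).exists_countable_dense_subset
  have haeD : ∀ᵐ t, ∀ x ∈ D, τ < t → ⟪toL2 (u t) - uτ, toL2 x.1⟫_ℝ =
      (∫ r in τ..t, diffusionTerm a l h u r) x.1 +
      (∫ r in τ..t, reactionTerm f (ENNReal.ofReal p) (ENNReal.ofReal q) u r) x.2 := by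
    refine (ae_ball_iff hDc).2 fun x hx => ?_
    filter_upwards [(hu.ae_inner_sub_eq hκ hα hqp ha hf hgrow hh x.1 x.2 (hDV hx)).2]
      with t ht hτt
    have j1 := iΓ₁ (le_of_lt hτt)
    have j2 := iΓ₂ (le_of_lt hτt)
    rw [inner_sub_left, ht hτt, ContinuousLinearMap.intervalIntegral_apply j1,
      ContinuousLinearMap.intervalIntegral_apply j2, ← intervalIntegral.integral_add]
    · ring
    · exact ⟨j1.1.apply_continuousLinearMap _, j1.2.apply_continuousLinearMap _⟩
    · exact ⟨j2.1.apply_continuousLinearMap _, j2.2.apply_continuousLinearMap _⟩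
  refine ⟨{t | τ < t ∧ (∀ x ∈ D, τ < t → ⟪toL2 (u t) - uτ, toL2 x.1⟫_ℝ =
      (∫ r in τ..t, diffusionTerm a l h u r) x.1 +
      (∫ r in τ..t, reactionTerm f (ENNReal.ofReal p) (ENNReal.ofReal q) u r) x.2) ∧
      MemLp (toL2 (u t)) (ENNReal.ofReal p) (volume.restrict Ω)}, ?_⟩
  have hident : ∀ t, τ < t → (∀ x ∈ D, τ < t → ⟪toL2 (u t) - uτ, toL2 x.1⟫_ℝ =
      (∫ r in τ..t, diffusionTerm a l h u r) x.1 +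
      (∫ r in τ..t, reactionTerm f (ENNReal.ofReal p) (ENNReal.ofReal q) u r) x.2) →
      ∀ x ∈ V, ⟪toL2 (u t) - uτ, toL2 x.1⟫_ℝ =
      (∫ r in τ..t, diffusionTerm a l h u r) x.1 +
      (∫ r in τ..t, reactionTerm f (ENNReal.ofReal p) (ENNReal.ofReal q) u r) x.2 := by
    intro t hτt hD x hx
    have hcl : IsClosed {x : H10 Ω × Lp ℝ (ENNReal.ofReal p) (volume.restrict Ω) |
        ⟪toL2 (u t) - uτ, toL2L Ω x.1⟫_ℝ = (∫ r in τ..t, diffusionTerm a l h u r) x.1 +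
        (∫ r in τ..t, reactionTerm f (ENNReal.ofReal p) (ENNReal.ofReal q) u r) x.2} :=
      isClosed_eq (by fun_prop) (by fun_prop)
    exact hcl.closure_subset_iff.2 (fun x hx => hD x hx hτt) (hVD hx)
  refine
    { ae_mem := ?_
      subset_Ioi := fun t ht => ht.1
      memLp_z := fun T hT => (toL2L Ω).comp_memLp' (hu.memLp_two T hT)
      memLp_Γ₁ := mΓ₁
      memLp_Z₁ := hu.memLp_two
      memLp_Γ₂ := mΓ₂
      memLp_Z₂ := fun T hT => (mZ₂ T hT).1
      inner_sub := ?_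
      exists_dense := ?_ }
  · filter_upwards [haeD, ae_of_forall_ae_Ioo fun T hT => (mZ₂ T hT).2] with t h1 h2 hτt
    exact ⟨hτt, h1, h2 hτt⟩
  · rintro t ⟨hτt, ht, -⟩ s ⟨-, -, hs⟩
    exact hident t hτt ht (u s, nemytskii (fun s => s) (ENNReal.ofReal p) (toL2 (u s)))
      (coeFn_nemytskii (f := fun s => s) hs).symm
  · refine ⟨_, dense_toL2 hΩ (ENNReal.ofReal p), ?_⟩
    rintro _ ⟨v, hv, rfl⟩
    have hvy := hv.coeFn_toLp.symm
    have hG := hu.ae_inner_sub_eq hκ hα hqp ha hf hgrow hh v (hv.toLp _) hvy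
    refine ⟨_, continuousOn_primitive_Ici hG.1, intervalIntegral.integral_same, ?_⟩
    rintro t ⟨hτt, ht, -⟩
    have h1 := hident t hτt ht (v, hv.toLp _) hvy
    have j1 := iΓ₁ (le_of_lt hτt)
    have j2 := iΓ₂ (le_of_lt hτt)
    rw [inner_sub_left, ContinuousLinearMap.intervalIntegral_apply j1,
      ContinuousLinearMap.intervalIntegral_apply j2, ← intervalIntegral.integral_add] at h1
    · linarith
    · exact ⟨j1.1.apply_continuousLinearMap _, j1.2.apply_continuousLinearMap _⟩
    · exact ⟨j2.1.apply_continuousLinearMap _, j2.2.apply_continuousLinearMap _⟩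

end IsWeakSolution
end

/-! ### The norm dual to `|∇v|` -/

section
variable {N : ℕ} {Ω : Set (EuclideanSpace ℝ (Fin N))}

section dualNorm

theorem dualNorm_nonneg (ξ : HMinusOne Ω) : 0 ≤ dualNorm ξ :=
  Real.sInf_nonneg fun _ hC => hC.1

theorem dualNorm_le_of_forall {ξ : HMinusOne Ω} {C : ℝ} (hC : 0 ≤ C)
    (h : ∀ v : H10 Ω, |ξ v| ≤ C * ‖weakGrad v‖) : dualNorm ξ ≤ C :=
  csInf_le ⟨0, fun _ hC => hC.1⟩ ⟨hC, h⟩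

variable [IsFiniteMeasure (volume.restrict Ω)]

/-- For `λ₁ > 0` the norms `|∇v|` and `(|v|² + |∇v|²)^{1/2}` are equivalent. -/
theorem norm_le_mul_norm_weakGrad (hlam : 0 < firstEigenvalue Ω) (v : H10 Ω) :
    ‖v‖ ≤ √((firstEigenvalue Ω)⁻¹ + 1) * ‖weakGrad v‖ := by
  have h1 := firstEigenvalue_mul_norm_sq_le v
  have h2 : ‖toL2 v‖ ^ 2 ≤ (firstEigenvalue Ω)⁻¹ * ‖weakGrad v‖ ^ 2 := by
    rw [inv_mul_eq_div, le_div_iff₀ hlam]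
    linarith
  refine le_of_sq_le_sq ?_ (by positivity)
  rw [mul_pow, Real.sq_sqrt (by positivity), norm_sq_H10]
  linarith

theorem abs_apply_le_norm_mul (hlam : 0 < firstEigenvalue Ω) (ξ : HMinusOne Ω) (v : H10 Ω) :
    |ξ v| ≤ √((firstEigenvalue Ω)⁻¹ + 1) * ‖ξ‖ * ‖weakGrad v‖ := by
  calc |ξ v| ≤ ‖ξ‖ * ‖v‖ := ξ.le_opNorm v
    _ ≤ ‖ξ‖ * (√((firstEigenvalue Ω)⁻¹ + 1) * ‖weakGrad v‖) := by
      gcongr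
      exact norm_le_mul_norm_weakGrad hlam v
    _ = _ := by ring

/-- The infimum defining the dual norm is attained. Poincaré's inequality makes the set of
admissible constants nonempty. -/
theorem abs_apply_le_dualNorm_mul (hlam : 0 < firstEigenvalue Ω) (ξ : HMinusOne Ω) (v : H10 Ω) :
    |ξ v| ≤ dualNorm ξ * ‖weakGrad v‖ := by
  have hmem := abs_apply_le_norm_mul hlam ξ
  rcases (norm_nonneg (weakGrad v)).eq_or_lt with h | h
  · have := hmem v
    rw [← h, mul_zero] at this ⊢
    exact this
  · rw [← div_le_iff₀ h]
    refine le_csInf ⟨_, by positivity, hmem⟩ fun C hC => ?_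
    rw [div_le_iff₀ h]
    exact hC.2 v

theorem dualNorm_le (hlam : 0 < firstEigenvalue Ω) (ξ : HMinusOne Ω) :
    dualNorm ξ ≤ √((firstEigenvalue Ω)⁻¹ + 1) * ‖ξ‖ :=
  dualNorm_le_of_forall (by positivity) (abs_apply_le_norm_mul hlam ξ)

/-- Continuity, which makes `s ↦ ‖h(s)‖_*` measurable. -/
theorem continuous_dualNorm (hlam : 0 < firstEigenvalue Ω) :
    Continuous (dualNorm : HMinusOne Ω → ℝ) := by
  refine (LipschitzWith.of_le_add_mul (Real.toNNReal √((firstEigenvalue Ω)⁻¹ + 1))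
    fun ξ ζ => ?_).continuous
  rw [Real.coe_toNNReal _ (Real.sqrt_nonneg _), dist_eq_norm]
  refine dualNorm_le_of_forall (add_nonneg (dualNorm_nonneg ζ) (by positivity)) fun v => ?_
  have h1 := abs_apply_le_dualNorm_mul hlam ζ v
  have h2 := abs_apply_le_norm_mul hlam (ξ - ζ) v
  have h3 : ξ v = ζ v + (ξ - ζ) v := by simp
  rw [h3, add_mul]
  exact (abs_add_le _ _).trans (add_le_add h1 h2)

theorem intervalIntegrable_dualNorm_sq (hlam : 0 < firstEigenvalue Ω) {h : ℝ → HMinusOne Ω}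
    (hh : ∀ b c, MemLp h 2 (volume.restrict (Ioo b c))) {τ t : ℝ} (ht : τ ≤ t) :
    IntervalIntegrable (fun s => dualNorm (h s) ^ 2) volume τ t := by
  rw [intervalIntegrable_iff_integrableOn_Ioo_of_le ht]
  refine MemLp.integrable_sq (MemLp.of_le_mul (c := √((firstEigenvalue Ω)⁻¹ + 1)) (hh τ t)
    ((continuous_dualNorm hlam).comp_aestronglyMeasurable (hh τ t).1) (ae_of_all _ fun s => ?_))
  rw [Real.norm_of_nonneg (dualNorm_nonneg _)]
  exact dualNorm_le hlam _

end dualNorm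

/-! ### The energy estimate -/

/-- Gronwall's inequality for an absolutely continuous function `E` with derivative `ψ`. -/
theorem exp_mul_le_of_deriv_le {E ψ g : ℝ → ℝ} {μ τ t : ℝ} (ht : τ ≤ t)
    (hψ : IntervalIntegrable ψ volume τ t) (hg : IntervalIntegrable g volume τ t)
    (hE : ∀ s ∈ Icc τ t, E s - E τ = ∫ r in τ..s, ψ r)
    (hle : ∀ᵐ s ∂(volume.restrict (Icc τ t)), ψ s ≤ -μ * E s + g s) :
    Real.exp (μ * t) * E t ≤ Real.exp (μ * τ) * E τ + ∫ s in τ..t, Real.exp (μ * s) * g s := by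
  have hφ : ContDiff ℝ 1 (fun s => Real.exp (μ * s)) := by fun_prop
  have hd : deriv (fun s => Real.exp (μ * s)) = fun s => Real.exp (μ * s) * μ := by
    ext s
    have := ((hasDerivAt_id s).const_mul μ).exp
    simpa using this.deriv
  have h1 := integral_deriv_mul_primitive hψ hφ
  have hEc : ContinuousOn E (uIcc τ t) := by
    have := (intervalIntegral.continuousOn_primitive_interval' hψ left_mem_uIcc).add
      (continuousOn_const (c := E τ))
    refine this.congr fun s hs => ?_
    rw [uIcc_of_le ht] at hs
    simp only [Pi.add_apply]
    linarith [hE s hs]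
  have hexp : ContinuousOn (fun s => Real.exp (μ * s)) (uIcc τ t) := by fun_prop
  have iψ : IntervalIntegrable (fun s => Real.exp (μ * s) * ψ s) volume τ t :=
    hψ.continuousOn_mul hexp
  have ig : IntervalIntegrable (fun s => Real.exp (μ * s) * g s) volume τ t :=
    hg.continuousOn_mul hexp
  have iE : IntervalIntegrable (fun s => Real.exp (μ * s) * μ * E s) volume τ t :=
    ((hexp.mul continuousOn_const).mul hEc).intervalIntegrable
  have ic : IntervalIntegrable (fun s => Real.exp (μ * s) * μ * E τ) volume τ t :=
    ((hexp.mul continuousOn_const).mul continuousOn_const).intervalIntegrable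
  have h2 : ∫ s in τ..t, deriv (fun s => Real.exp (μ * s)) s * (∫ r in τ..s, ψ r) =
      (∫ s in τ..t, Real.exp (μ * s) * μ * E s) -
        (Real.exp (μ * t) - Real.exp (μ * τ)) * E τ := by
    have h3 : ∫ s in τ..t, Real.exp (μ * s) * μ = Real.exp (μ * t) - Real.exp (μ * τ) := by
      rw [← hd]
      exact intervalIntegral.integral_deriv_eq_sub (fun s _ => by fun_prop)
        (by rw [hd]; exact (hexp.mul continuousOn_const).intervalIntegrable)
    rw [← h3, ← intervalIntegral.integral_mul_const, ← intervalIntegral.integral_sub iE ic, hd]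
    refine intervalIntegral.integral_congr fun s hs => ?_
    rw [uIcc_of_le ht] at hs
    simp only [← hE s hs]
    ring
  rw [h2, ← hE t ⟨ht, le_rfl⟩] at h1
  have h4 : (∫ s in τ..t, Real.exp (μ * s) * μ * E s) + (∫ s in τ..t, Real.exp (μ * s) * ψ s) ≤
      ∫ s in τ..t, Real.exp (μ * s) * g s := by
    rw [← intervalIntegral.integral_add iE iψ]
    refine intervalIntegral.integral_mono_ae_restrict ht (iE.add iψ) ig ?_
    filter_upwards [hle] with s hs
    nlinarith [Real.exp_pos (μ * s)]
  linarith

/-- The contribution of the reaction term to the energy is bounded above by `κ₂ |Ω|`. -/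
theorem integral_mul_self_le [IsFiniteMeasure (volume.restrict Ω)] {f : ℝ → ℝ} {κ₂ α₂ p q : ℝ}
    (hα : 0 ≤ α₂) [(ENNReal.ofReal q).HolderConjugate (ENNReal.ofReal p)]
    (hdiss : ∀ s, f s * s ≤ κ₂ - α₂ * |s| ^ p) {v : EuclideanSpace ℝ (Fin N) → ℝ}
    (h1 : MemLp v (ENNReal.ofReal p) (volume.restrict Ω))
    (h2 : MemLp (fun x => f (v x)) (ENNReal.ofReal q) (volume.restrict Ω)) :
    ∫ x in Ω, f (v x) * v x ≤ κ₂ * volume.real Ω := by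
  have hi : Integrable (fun x => f (v x) * v x) (volume.restrict Ω) := h2.integrable_mul h1
  calc ∫ x in Ω, f (v x) * v x ≤ ∫ _ in Ω, κ₂ := by
        refine integral_mono hi (integrable_const _) fun x => ?_
        have := Real.rpow_nonneg (abs_nonneg (v x)) p
        have := hdiss (v x)
        simp only
        nlinarith
    _ = κ₂ * volume.real Ω := by
        rw [setIntegral_const, smul_eq_mul, mul_comm]

/-- The dissipation estimate: for `0 < μ < 2 m λ₁`, the part `μ |u|²` of `2 m |∇u|²` is split off by
Poincaré's inequality, and what is left absorbs the forcing by Young's inequality. -/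
theorem neg_mul_norm_sq_add_apply_le [IsFiniteMeasure (volume.restrict Ω)] {m μ A : ℝ}
    (hlam : 0 < firstEigenvalue Ω) (hμ : 0 ≤ μ) (hμm : μ < 2 * m * firstEigenvalue Ω)
    (hA : m ≤ A) (ξ : HMinusOne Ω) (v : H10 Ω) :
    2 * (-(A * ‖weakGrad v‖ ^ 2) + ξ v) ≤
      -μ * ‖toL2 v‖ ^ 2 + 1 / (2 * (m - μ * (2 * firstEigenvalue Ω)⁻¹)) * dualNorm ξ ^ 2 := by
  set ε := m - μ * (2 * firstEigenvalue Ω)⁻¹ with hε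
  have hεpos : 0 < ε := by
    rw [hε, sub_pos, ← div_eq_mul_inv, div_lt_iff₀ (by positivity)]
    linarith
  have h1 := firstEigenvalue_mul_norm_sq_le v
  have h2 : μ * ‖toL2 v‖ ^ 2 ≤ 2 * (μ * (2 * firstEigenvalue Ω)⁻¹) * ‖weakGrad v‖ ^ 2 := by
    have : 2 * (μ * (2 * firstEigenvalue Ω)⁻¹) * ‖weakGrad v‖ ^ 2 =
        μ * (‖weakGrad v‖ ^ 2 / firstEigenvalue Ω) := by
      field_simp
    rw [this]
    gcongr
    rw [le_div_iff₀ hlam]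
    linarith
  have h3 : ξ v ≤ dualNorm ξ * ‖weakGrad v‖ :=
    (le_abs_self _).trans (abs_apply_le_dualNorm_mul hlam ξ v)
  have h4 : 2 * (dualNorm ξ * ‖weakGrad v‖) ≤
      2 * ε * ‖weakGrad v‖ ^ 2 + 1 / (2 * ε) * dualNorm ξ ^ 2 := by
    -- the difference of the two sides is a multiple of a square
    have : 2 * ε * ‖weakGrad v‖ ^ 2 + 1 / (2 * ε) * dualNorm ξ ^ 2 -
        2 * (dualNorm ξ * ‖weakGrad v‖) =
        1 / (2 * ε) * (2 * ε * ‖weakGrad v‖ - dualNorm ξ) ^ 2 := by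
      field_simp
      ring
    have h5 : 0 ≤ 1 / (2 * ε) * (2 * ε * ‖weakGrad v‖ - dualNorm ξ) ^ 2 := by positivity
    linarith
  have h5 : m * ‖weakGrad v‖ ^ 2 ≤ A * ‖weakGrad v‖ ^ 2 := by gcongr
  have h6 : 2 * ε * ‖weakGrad v‖ ^ 2 = 2 * m * ‖weakGrad v‖ ^ 2 -
      2 * (μ * (2 * firstEigenvalue Ω)⁻¹) * ‖weakGrad v‖ ^ 2 := by
    rw [hε]
    ring
  linarith

/-- The estimate for the continuous representative `w` of a weak solution. -/
theorem IsWeakSolution.norm_sq_le [IsFiniteMeasure (volume.restrict Ω)] {p q : ℝ} {a f : ℝ → ℝ}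
    {l : L2 Ω} {h : ℝ → HMinusOne Ω} {τ : ℝ} {uτ : L2 Ω} {u : ℝ → H10 Ω} {κ₁ α₁ κ₂ α₂ m : ℝ}
    [Fact (1 ≤ ENNReal.ofReal p)] [Fact (1 ≤ ENNReal.ofReal q)]
    [(ENNReal.ofReal q).HolderConjugate (ENNReal.ofReal p)]
    (hκ : 0 ≤ κ₁) (hα : 0 ≤ α₁) (hα₂ : 0 ≤ α₂) (hκ₂ : 0 ≤ κ₂)
    (hqp : q.HolderConjugate p) (hm : ∀ s, m ≤ a s) (hf : Continuous f)
    (hgrow : ∀ s, |f s| ≤ κ₁ + α₁ * |s| ^ (p - 1))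
    (hdiss : ∀ s, f s * s ≤ κ₂ - α₂ * |s| ^ p)
    (hh : ∀ b c, MemLp h 2 (volume.restrict (Ioo b c)))
    (hu : IsWeakSolution p a f l h τ uτ u) {G : Set ℝ}
    (hz : IsWeakEvolution (ENNReal.ofReal p) (ENNReal.ofReal q) τ uτ G (fun t => toL2 (u t))
      (diffusionTerm a l h u) u (reactionTerm f (ENNReal.ofReal p) (ENNReal.ofReal q) u)
      (fun t => nemytskii (fun s => s) (ENNReal.ofReal p) (toL2 (u t))))
    {w : ℝ → L2 Ω} (hw : ContinuousOn w (Ici τ)) (hwz : ∀ t ∈ G, w t = toL2 (u t))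
    (hlam : 0 < firstEigenvalue Ω) {μ : ℝ} (hμ : 0 < μ) (hμm : μ < 2 * m * firstEigenvalue Ω)
    {t : ℝ} (ht : τ ≤ t) :
    ‖w t‖ ^ 2 ≤ Real.exp (-μ * (t - τ)) * ‖w τ‖ ^ 2 + 2 * κ₂ * volume.real Ω / μ
      + 1 / (2 * (m - μ * (2 * firstEigenvalue Ω)⁻¹)) * Real.exp (-μ * t)
        * ∫ s in τ..t, Real.exp (μ * s) * dualNorm (h s) ^ 2 := by
  have hpt : ENNReal.ofReal p ≠ ⊤ := ENNReal.ofReal_ne_top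
  have hqt : ENNReal.ofReal q ≠ ⊤ := ENNReal.ofReal_ne_top
  set K := 1 / (2 * (m - μ * (2 * firstEigenvalue Ω)⁻¹)) with hK
  set c := 2 * κ₂ * volume.real Ω with hc
  set ψ := fun r => 2 * (diffusionTerm a l h u r (u r) +
    reactionTerm f (ENNReal.ofReal p) (ENNReal.ofReal q) u r
      (nemytskii (fun s => s) (ENNReal.ofReal p) (toL2 (u r)))) with hψ
  have hae : ∀ᵐ r, τ < r → ψ r ≤ -μ * ‖w r‖ ^ 2 + (c + K * dualNorm (h r) ^ 2) := by
    filter_upwards [hz.ae_mem,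
      ae_of_forall_ae_Ioo fun T hT => (hu.memLp_nemytskii_id hqp.symm.lt.le hT).2,
      ae_of_forall_ae_Ioo fun T hT => (hu.memLp_nemytskii_reaction hκ hα hqp hf hgrow hT).2]
      with r h1 h2 h3 hr
    have e1 : reactionTerm f (ENNReal.ofReal p) (ENNReal.ofReal q) u r
        (nemytskii (fun s => s) (ENNReal.ofReal p) (toL2 (u r))) =
        ∫ x in Ω, f (toL2 (u r) x) * toL2 (u r) x :=
      integralPairing_apply (coeFn_nemytskii (h3 hr))
        (coeFn_nemytskii (f := fun s => s) (h2 hr))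
    have e2 : diffusionTerm a l h u r (u r) =
        -(a ⟪l, toL2 (u r)⟫_ℝ * ‖weakGrad (u r)‖ ^ 2) + h r (u r) := by
      rw [← real_inner_self_eq_norm_sq]
      rfl
    have e3 := integral_mul_self_le hα₂ hdiss (h2 hr) (h3 hr)
    have e4 := neg_mul_norm_sq_add_apply_le hlam hμ.le hμm (hm ⟪l, toL2 (u r)⟫_ℝ) (h r) (u r)
    rw [hwz r (h1 hr), hψ]
    simp only
    rw [e1, e2]
    linarith
  have hD := intervalIntegrable_dualNorm_sq hlam hh ht
  have hg : IntervalIntegrable (fun r => c + K * dualNorm (h r) ^ 2) volume τ t :=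
    intervalIntegrable_const.add (hD.const_mul K)
  have hmain := exp_mul_le_of_deriv_le (E := fun r => ‖w r‖ ^ 2) (μ := μ) ht
    ((hz.intervalIntegrable_pairing ht).const_mul 2) hg
    (fun s hs => by
      rw [intervalIntegral.integral_const_mul]
      exact hz.norm_sq_sub_norm_sq hpt hqt hw hwz hs.1)
    (by
      rw [← Measure.restrict_congr_set Ioc_ae_eq_Icc, ae_restrict_iff' measurableSet_Ioc]
      filter_upwards [hae] with r hr hrt using hr hrt.1)
  have hexp : ContinuousOn (fun s => Real.exp (μ * s)) (uIcc τ t) := by fun_prop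
  have hsplit : ∫ s in τ..t, Real.exp (μ * s) * (c + K * dualNorm (h s) ^ 2) =
      c * (∫ s in τ..t, Real.exp (μ * s)) +
        K * ∫ s in τ..t, Real.exp (μ * s) * dualNorm (h s) ^ 2 := by
    rw [← intervalIntegral.integral_const_mul, ← intervalIntegral.integral_const_mul,
      ← intervalIntegral.integral_add (hexp.intervalIntegrable.const_mul c)
        ((hD.continuousOn_mul hexp).const_mul K)]
    exact intervalIntegral.integral_congr fun s _ => by ring
  have hint : ∫ s in τ..t, Real.exp (μ * s) = (Real.exp (μ * t) - Real.exp (μ * τ)) / μ := by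
    rw [intervalIntegral.integral_comp_mul_left (fun s => Real.exp s) hμ.ne', integral_exp,
      smul_eq_mul, inv_mul_eq_div]
  have hc0 : 0 ≤ c := by positivity
  have hcint : c * (∫ s in τ..t, Real.exp (μ * s)) ≤ Real.exp (μ * t) * (c / μ) := by
    rw [hint]
    have h5 : Real.exp (μ * t) * (c / μ) - c * ((Real.exp (μ * t) - Real.exp (μ * τ)) / μ) =
        c * Real.exp (μ * τ) / μ := by ring
    have h6 : 0 ≤ c * Real.exp (μ * τ) / μ := by positivity
    linarith
  rw [hsplit] at hmain
  refine le_of_mul_le_mul_left ?_ (Real.exp_pos (μ * t))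
  have x1 : Real.exp (μ * t) * Real.exp (-μ * (t - τ)) = Real.exp (μ * τ) := by
    rw [← Real.exp_add]
    ring_nf
  have x2 : Real.exp (μ * t) * Real.exp (-μ * t) = 1 := by
    rw [← Real.exp_add]
    simp
  calc Real.exp (μ * t) * ‖w t‖ ^ 2 ≤ Real.exp (μ * τ) * ‖w τ‖ ^ 2 + Real.exp (μ * t) * (c / μ)
        + K * ∫ s in τ..t, Real.exp (μ * s) * dualNorm (h s) ^ 2 := by linarith
    _ = Real.exp (μ * t) * Real.exp (-μ * (t - τ)) * ‖w τ‖ ^ 2 + Real.exp (μ * t) * (c / μ)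
        + K * (Real.exp (μ * t) * Real.exp (-μ * t)) *
          ∫ s in τ..t, Real.exp (μ * s) * dualNorm (h s) ^ 2 := by rw [x1, x2, mul_one]
    _ = _ := by ring

end

theorem mainTheorem6 {N : ℕ} (hN : 1 ≤ N) (Ω : Set (EuclideanSpace ℝ (Fin N)))
    (hΩ_open : IsOpen Ω) (hΩ_conn : IsConnected Ω) (hΩ_bdd : Bornology.IsBounded Ω)
    (α₁ α₂ m κ₁ κ₂ p : ℝ) (a f : Ioc (0 : ℝ) 1 → ℝ → ℝ)
    (h : Ioc (0 : ℝ) 1 → ℝ → HMinusOne Ω) (l : Ioc (0 : ℝ) 1 → L2 Ω)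
    (hA1 : AssumptionA1 α₁ α₂ m κ₁ κ₂ p a f h)
    (η : Ioc (0 : ℝ) 1) (τ : ℝ) (uτ : L2 Ω) (u : ℝ → H10 Ω)
    (hu : IsWeakSolution p (a η) (f η) (l η) (h η) τ uτ u) :
    ∃ w : ℝ → L2 Ω, ContinuousOn w (Ici τ) ∧ w τ = uτ ∧
      (∀ᵐ t ∂(volume.restrict (Ioi τ)), w t = toL2 (u t)) ∧
      ∀ μ ∈ Ioo (0 : ℝ) (2 * m * firstEigenvalue Ω), ∀ t, τ ≤ t →
        ‖w t‖ ^ 2 ≤ Real.exp (-μ * (t - τ)) * ‖uτ‖ ^ 2 + 2 * κ₂ * volume.real Ω / μ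
          + 1 / (2 * (m - μ * (2 * firstEigenvalue Ω)⁻¹)) * Real.exp (-μ * t)
            * ∫ s in τ..t, Real.exp (μ * s) * dualNorm (h η s) ^ 2 := by
  have hfin : IsFiniteMeasure (volume.restrict Ω) :=
    isFiniteMeasure_restrict.2 hΩ_bdd.measure_lt_top.ne
  have hp1 : 1 < p := by linarith [hA1.two_le_p]
  have hqp : (p / (p - 1)).HolderConjugate p := (Real.HolderConjugate.conjExponent hp1).symm
  have : Fact (1 ≤ ENNReal.ofReal p) := ⟨ENNReal.one_le_ofReal.2 hp1.le⟩
  have : Fact (1 ≤ ENNReal.ofReal (p / (p - 1))) := ⟨ENNReal.one_le_ofReal.2 hqp.lt.le⟩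
  have : (ENNReal.ofReal (p / (p - 1))).HolderConjugate (ENNReal.ofReal p) := hqp.ennrealOfReal
  have hκ := hA1.κ₁_nonneg
  have hα := hA1.α₁_pos.le
  have hh := hA1.memLp_h η
  obtain ⟨G, hz⟩ := hu.exists_isWeakEvolution hΩ_open hκ hα hqp (hA1.continuous_a η)
    (hA1.continuous_f η) (hA1.growth_f η) hh
  obtain ⟨w, hw, hwτ, hwz⟩ := hz.exists_continuousOn ENNReal.ofReal_ne_top ENNReal.ofReal_ne_top
  refine ⟨w, hw, hwτ, ?_, fun μ hμ t ht => ?_⟩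
  · rw [ae_restrict_iff' measurableSet_Ioi]
    filter_upwards [hz.ae_mem] with t h1 h2 using hwz t (h1 h2)
  -- the interval of admissible `μ` is empty unless `λ₁ > 0`
  · have hlam : 0 < firstEigenvalue Ω :=
      pos_of_mul_pos_right (hμ.1.trans hμ.2) (mul_nonneg zero_le_two hA1.m_pos.le)
    rw [← hwτ]
    exact hu.norm_sq_le hκ hα hA1.α₂_pos.le hA1.κ₂_nonneg hqp (hA1.le_a η) (hA1.continuous_f η)
      (hA1.growth_f η) (hA1.dissipative_f η) hh hz hw hwz hlam hμ.1 hμ.2 ht
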